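/- For $A\in\mathbb R^{n\times n}$ and an entrywise nonnegative $\Delta\in\mathbb R^{n\times n}$ (where $n\ge 0$) let $$r(A,\Delta)=\min\{\delta\ge 0 \mid [A-\delta\Delta,\,A+\delta\Delta]\text{ contains a singular matrix}\}$$ be the generalized regularity radius, where $[L,U]$ is the set of real matrices $B$ with $L\le B\le U$ entrywise, and $r(A,\Delta)=\infty$ if no such $\delta$ exists. (a) Deciding whether $r(A,\Delta)=\infty$ is a polynomial problem. Precisely, there are a single random access program and a single polynomial $p$ such that the following holds. The program works with natural-number registers (addition, truncated subtraction, comparison, used also as addresses) and with arrays of numbers that can only be added, subtracted, multiplied, divided and compared, starting from $0$, $1$ and the entries of $A$ and $\Delta$; a natural number is always charged its bit length. - Real inputs: for all $n$ and all real $A$ and $\Delta\ge 0$, the program halts with the correct answer at cost at most $p(n)$, where each operation has unit cost regardless of the real numbers involved. - Rational inputs: for all $n$ and all rational $A$ and $\Delta\ge 0$, the program halts with the correct answer at cost at most $p(L)$, where $L$ is the total bit length of the entries of $A$ and $\Delta$ and each operation costs, in addition to one unit, the bit length of the numbers involved (rational numbers being written in lowest terms). (b) For real $A$ and $\Delta\ge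 0$ consider the following procedure. Start with $I=\{k\mid \Delta_{k*}=0\}$. As long as there are $i,j$ with $\Delta_{ij}>0$ and $x_j=0$ for every $x\in\{x\in\mathbb R^n\mid A_{k*}x=0,\ k\in I\}$, choose any such $i,j$ and put $\Delta_{ij}:=0$; if now $\Delta_{i*}=0$, put $I:=I\cup\{i\}$. Whatever choices are made, the procedure ends after at most $n^2$ steps. If $A$ is nonsingular then, whatever choices are made, $r(A,\Delta)=\infty$ for the original $\Delta$ if and only if the procedure ends with $I=\{1,\dots,n\}$. -/

import Mathlib

open scoped NNReal ENNReal

namespace RegRadius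

/-! ### Interval matrices and the regularity radius -/

/-- The interval matrix `[lo, hi]`: all real matrices lying entrywise between `lo` and `hi`. -/
def intervalMatrix {n : ℕ} (lo hi : Matrix (Fin n) (Fin n) ℝ) :
    Set (Matrix (Fin n) (Fin n) ℝ) :=
  {B | ∀ i j, lo i j ≤ B i j ∧ B i j ≤ hi i j}

/-- A set of matrices (in use: an interval matrix) is regular if it consists merely of
nonsingular matrices. -/
def IsRegularSet {n : ℕ} (M : Set (Matrix (Fin n) (Fin n) ℝ)) : Prop :=
  ∀ B ∈ M, B.det ≠ 0

/-- The generalized regularity radius `r(A, Δ) = min {δ ≥ 0 | [A - δ Δ, A + δ Δ] is singular}`,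
with value `∞` if there is no such `δ`. (When the set is nonempty the infimum is attained, since
the set of such `δ` is closed.) -/
noncomputable def regularityRadius {n : ℕ} (A Δ : Matrix (Fin n) (Fin n) ℝ) : ℝ≥0∞ :=
  sInf ((fun δ : ℝ≥0 => (δ : ℝ≥0∞)) ''
    {δ : ℝ≥0 | ¬ IsRegularSet (intervalMatrix (A - (δ : ℝ) • Δ) (A + (δ : ℝ) • Δ))})

/-! ### The reduction procedure -/

/-- The vector space of all `x` with `A_{k*} x = 0` for every `k ∈ I`. -/
def rowKernel {n : ℕ} (A : Matrix (Fin n) (Fin n) ℝ) (I : Set (Fin n)) :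
    Submodule ℝ (Fin n → ℝ) where
  carrier := {x | ∀ k ∈ I, A k ⬝ᵥ x = 0}
  zero_mem' := by
    intro k _
    simp
  add_mem' := by
    intro x y hx hy k hk
    rw [dotProduct_add, hx k hk, hy k hk, add_zero]
  smul_mem' := by
    intro c x hx k hk
    rw [dotProduct_smul, hx k hk, smul_zero]

/-- A stage of the procedure: the current radius matrix and the current index set `I`. -/
structure Stage (n : ℕ) where
  rad : Matrix (Fin n) (Fin n) ℝ
  rows : Set (Fin n)

/-- The initial stage: `I` is the set of indices of the zero rows of `Δ`. -/
def Stage.initial {n : ℕ} (Δ : Matrix (Fin n) (Fin n) ℝ) : Stage n where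
  rad := Δ
  rows := {k | ∀ l, Δ k l = 0}

/-- Put the `(i, j)` entry of the radius matrix to zero and, if the `i`th row has become zero,
add `i` to the index set. -/
def Stage.clear {n : ℕ} (S : Stage n) (i j : Fin n) : Stage n where
  rad := S.rad.updateRow i (Function.update (S.rad i) j 0)
  rows := S.rows ∪
    {k | k = i ∧ ∀ l, S.rad.updateRow i (Function.update (S.rad i) j 0) i l = 0}

/-- One step of the procedure: some positive entry `(i, j)` of the radius matrix, such that
`x_j = 0` on the whole of the current space, is cleared. -/
inductive Stage.Step {n : ℕ} (A : Matrix (Fin n) (Fin n) ℝ) : Stage n → Stage n → Prop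
  | clear (S : Stage n) (i j : Fin n) (hpos : 0 < S.rad i j)
      (hvanish : ∀ x ∈ rowKernel A S.rows, x j = 0) : Stage.Step A S (S.clear i j)

/-- The procedure started at `Δ` can end at the stage `S`: some sequence of steps leads to `S`,
and no step is possible there. -/
def Stage.EndsAt {n : ℕ} (A Δ : Matrix (Fin n) (Fin n) ℝ) (S : Stage n) : Prop :=
  Relation.ReflTransGen (Stage.Step A) (Stage.initial Δ) S ∧ ∀ T, ¬ Stage.Step A S T

/-! ### The machine model

Random access programs over an ordered field `K`. A memory has index registers, holding natural
numbers, and two-dimensional arrays of elements of `K`, which are addressed through natural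
numbers. The only constants of type `K` in a program are `0` and `1`; an element of `K` can be
added, subtracted, multiplied, divided and compared, and nothing else (no rounding, no access to
its digits). A weight `w : K → ℕ` says what handling an element of `K` costs in addition to the
unit cost of every operation: `w = 0` gives the unit cost real RAM, and the bit length on `ℚ` the
logarithmic cost model. Natural numbers are always charged by their bit length. -/

/-- The memory of a machine. -/
structure Mem (K : Type) where
  idx : ℕ → ℕ
  arr : ℕ → ℕ → ℕ → K

/-- Index expressions (`sub` is truncated subtraction). -/
inductive IdxExpr : Type
  | const (k : ℕ)
  | reg (r : ℕ)
  | add (a b : IdxExpr)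
  | sub (a b : IdxExpr)

def IdxExpr.val {K : Type} (σ : Mem K) : IdxExpr → ℕ
  | .const k => k
  | .reg r => σ.idx r
  | .add a b => a.val σ + b.val σ
  | .sub a b => a.val σ - b.val σ

/-- Every node of an expression costs `1` plus the bit length of its value. -/
def IdxExpr.cost {K : Type} (σ : Mem K) : IdxExpr → ℕ
  | .const k => 1 + Nat.size k
  | .reg r => 1 + Nat.size (σ.idx r)
  | .add a b => a.cost σ + b.cost σ + 1 + Nat.size (a.val σ + b.val σ)
  | .sub a b => a.cost σ + b.cost σ + 1 + Nat.size (a.val σ - b.val σ)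

/-- Expressions of type `K`; `read a i j` is the entry at `(i, j)` of the array `a`. -/
inductive NumExpr : Type
  | zero
  | one
  | read (a : ℕ) (i j : IdxExpr)
  | add (x y : NumExpr)
  | sub (x y : NumExpr)
  | mul (x y : NumExpr)
  | div (x y : NumExpr)

/-- The value of an expression (a division by zero returns zero). -/
def NumExpr.val {K : Type} [Field K] (σ : Mem K) : NumExpr → K
  | .zero => 0
  | .one => 1
  | .read a i j => σ.arr a (i.val σ) (j.val σ)
  | .add x y => x.val σ + y.val σ
  | .sub x y => x.val σ - y.val σ
  | .mul x y => x.val σ * y.val σ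
  | .div x y => x.val σ / y.val σ

/-- Every node of an expression costs `1` plus the weight of its value, and a memory access in
addition the cost of the address. -/
def NumExpr.cost {K : Type} [Field K] (w : K → ℕ) (σ : Mem K) : NumExpr → ℕ
  | .zero => 1 + w 0
  | .one => 1 + w 1
  | .read a i j => i.cost σ + j.cost σ + 1 + w (σ.arr a (i.val σ) (j.val σ))
  | .add x y => x.cost w σ + y.cost w σ + 1 + w (x.val σ + y.val σ)
  | .sub x y => x.cost w σ + y.cost w σ + 1 + w (x.val σ - y.val σ)
  | .mul x y => x.cost w σ + y.cost w σ + 1 + w (x.val σ * y.val σ)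
  | .div x y => x.cost w σ + y.cost w σ + 1 + w (x.val σ / y.val σ)

/-- Tests. -/
inductive Test : Type
  | idxLe (a b : IdxExpr)
  | numLe (x y : NumExpr)
  | neg (t : Test)
  | conj (s t : Test)

def Test.Holds {K : Type} [Field K] [LinearOrder K] (σ : Mem K) : Test → Prop
  | .idxLe a b => a.val σ ≤ b.val σ
  | .numLe x y => x.val σ ≤ y.val σ
  | .neg t => ¬ t.Holds σ
  | .conj s t => s.Holds σ ∧ t.Holds σ

def Test.cost {K : Type} [Field K] (w : K → ℕ) (σ : Mem K) : Test → ℕ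
  | .idxLe a b => a.cost σ + b.cost σ + 1
  | .numLe x y => x.cost w σ + y.cost w σ + 1
  | .neg t => t.cost w σ + 1
  | .conj s t => s.cost w σ + t.cost w σ + 1

/-- Programs. -/
inductive Prog : Type
  | skip
  | setIdx (r : ℕ) (e : IdxExpr)
  | write (a : ℕ) (i j : IdxExpr) (x : NumExpr)
  | seq (P Q : Prog)
  | ite (t : Test) (P Q : Prog)
  | loop (t : Test) (P : Prog)

/-- Put the index register `r` to `k`. -/
def Mem.setIdx {K : Type} (σ : Mem K) (r k : ℕ) : Mem K where
  idx := Function.update σ.idx r k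
  arr := σ.arr

/-- Put the entry at `(i, j)` of the array `a` to `x`. -/
def Mem.write {K : Type} (σ : Mem K) (a i j : ℕ) (x : K) : Mem K where
  idx := σ.idx
  arr := Function.update σ.arr a (Function.update (σ.arr a) i (Function.update (σ.arr a i) j x))

/-- `Exec w P σ c τ`: the program `P`, started in the memory `σ`, halts in the memory `τ` after a
computation of total cost `c`. The rules are deterministic. -/
inductive Exec {K : Type} [Field K] [LinearOrder K] (w : K → ℕ) :
    Prog → Mem K → ℕ → Mem K → Prop
  | skip (σ : Mem K) : Exec w .skip σ 1 σ
  | setIdx (σ : Mem K) (r : ℕ) (e : IdxExpr) :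
      Exec w (.setIdx r e) σ (e.cost σ + 1) (σ.setIdx r (e.val σ))
  | write (σ : Mem K) (a : ℕ) (i j : IdxExpr) (x : NumExpr) :
      Exec w (.write a i j x) σ (i.cost σ + j.cost σ + x.cost w σ + 1)
        (σ.write a (i.val σ) (j.val σ) (x.val σ))
  | seq (P Q : Prog) (σ τ υ : Mem K) (c d : ℕ) (hP : Exec w P σ c τ) (hQ : Exec w Q τ d υ) :
      Exec w (.seq P Q) σ (c + d) υ
  | iteTrue (t : Test) (P Q : Prog) (σ τ : Mem K) (c : ℕ) (ht : t.Holds σ)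
      (hP : Exec w P σ c τ) : Exec w (.ite t P Q) σ (t.cost w σ + 1 + c) τ
  | iteFalse (t : Test) (P Q : Prog) (σ τ : Mem K) (c : ℕ) (ht : ¬ t.Holds σ)
      (hQ : Exec w Q σ c τ) : Exec w (.ite t P Q) σ (t.cost w σ + 1 + c) τ
  | loopDone (t : Test) (P : Prog) (σ : Mem K) (ht : ¬ t.Holds σ) :
      Exec w (.loop t P) σ (t.cost w σ + 1) σ
  | loopStep (t : Test) (P : Prog) (σ τ υ : Mem K) (c d : ℕ) (ht : t.Holds σ)
      (hP : Exec w P σ c τ) (hL : Exec w (.loop t P) τ d υ) :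
      Exec w (.loop t P) σ (t.cost w σ + 1 + c + d) υ

/-- Started in the memory `σ`, the program halts after a computation of cost at most `bound`, and
the index register `0` then holds `1` if `Q` is true and `0` if `Q` is false. -/
def Prog.DecidesWithin {K : Type} [Field K] [LinearOrder K] (P : Prog) (w : K → ℕ) (σ : Mem K)
    (bound : ℕ) (Q : Prop) : Prop :=
  ∃ (c : ℕ) (τ : Mem K), Exec w P σ c τ ∧ c ≤ bound ∧
    (Q → τ.idx 0 = 1) ∧ (¬ Q → τ.idx 0 = 0)

/-- The initial memory for the input `(A, Δ)`: the index register `0` holds `n`, the arrays `0` and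
`1` hold `A` and `Δ` (in the rows and columns `0, …, n - 1`), everything else is zero. -/
def inputMem {K : Type} [Field K] {n : ℕ} (A Δ : Matrix (Fin n) (Fin n) K) : Mem K where
  idx := fun r => if r = 0 then n else 0
  arr := fun a i j =>
    if h : i < n ∧ j < n then
      if a = 0 then A ⟨i, h.1⟩ ⟨j, h.2⟩ else if a = 1 then Δ ⟨i, h.1⟩ ⟨j, h.2⟩ else 0
    else 0

/-- The bit length of a rational number: the bit lengths of its numerator and denominator, in
lowest terms, and a sign bit. -/
def ratBits (q : ℚ) : ℕ := Nat.size q.num.natAbs + Nat.size q.den + 1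

/-- The bit length of a rational input `(A, Δ)`. -/
def inputBits {n : ℕ} (A Δ : Matrix (Fin n) (Fin n) ℚ) : ℕ :=
  ∑ i, ∑ j, (ratBits (A i j) + ratBits (Δ i j))

end RegRadius

namespace RegRadius

/-! As `δ` grows, the interval at an entry with `Δ i j > 0` exhausts the real line, so the radius is
infinite exactly when every matrix `B` that agrees with `A` off the support of `Δ` is nonsingular.

Let `x` be a null vector of such a `B`. If every free entry of row `i` stands in a column `j` with
`x j = 0`, then `B i ⬝ᵥ x = A i ⬝ᵥ x`, so row `i` of `A` annihilates `x` too. Repeating this yields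
a set `I` of rows of `A` annihilating all null vectors of all compatible matrices. When it cannot be
enlarged, each row outside `I` has a free entry in a column not vanishing on the kernel `V` of the
rows in `I`. A generic `x` in `V` is nonzero at all such columns at once, and changing one entry in
each row outside `I` makes `B x = 0`. So the radius is infinite iff `V = 0`
(`CapturesNullVectors.regularityRadius_eq_top_iff`); for nonsingular `A` this means that `I` is
everything.

The decision program represents `V` by its orthogonal projector `P`. Column `j` vanishes on `V` iff
`P j j = 0`, and a new row costs one rank-one update, without pivoting. After `n` sweeps over all
rows nothing changes any more (`ProjState.closed_rounds`), and the trace of `P` tells whether `V =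
0`.

In the bit model the sizes do not accumulate: `P` depends only on `I`, its entries are at most `1`
in absolute value, and by `1 - P = Mᵀ (M Mᵀ)⁻¹ M` they have a Gram determinant as common denominator
(`IsKernelProjector.bitBounded`). An abstract notion of size (`IsSizeBound`) lets one cost analysis
serve both models. -/

/-! ### The radius is infinite iff every compatible matrix is nonsingular -/

/-- `B` agrees with `A` at the entries where `Δ` vanishes. -/
def AgreesOffSupport {n : ℕ} (A Δ B : Matrix (Fin n) (Fin n) ℝ) : Prop :=
  ∀ i j, Δ i j = 0 → B i j = A i j

/-- Any `δ` above all the ratios `|B i j - A i j| / Δ i j` works; their sum is such a bound. Where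
`Δ i j = 0` the ratio is `0` by convention and the deviation vanishes as well. -/
theorem AgreesOffSupport.exists_mem_intervalMatrix {n : ℕ} {A Δ B : Matrix (Fin n) (Fin n) ℝ}
    (hΔ : ∀ i j, 0 ≤ Δ i j) (h : AgreesOffSupport A Δ B) :
    ∃ δ : ℝ≥0, B ∈ intervalMatrix (A - (δ : ℝ) • Δ) (A + (δ : ℝ) • Δ) := by
  have hq : ∀ i j, 0 ≤ |B i j - A i j| / Δ i j := fun i j => div_nonneg (abs_nonneg _) (hΔ i j)
  have h0 : 0 ≤ ∑ i, ∑ j, |B i j - A i j| / Δ i j :=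
    Finset.sum_nonneg fun i _ => Finset.sum_nonneg fun j _ => hq i j
  obtain ⟨δ, hδ⟩ : ∃ δ : ℝ≥0, (δ : ℝ) = ∑ i, ∑ j, |B i j - A i j| / Δ i j := ⟨⟨_, h0⟩, rfl⟩
  refine ⟨δ, fun i j => ?_⟩
  have hle : |B i j - A i j| ≤ (∑ i, ∑ j, |B i j - A i j| / Δ i j) * Δ i j := by
    rcases eq_or_lt_of_le (hΔ i j) with hz | hp
    · rw [h i j hz.symm, ← hz]
      simp
    · rw [← div_le_iff₀ hp]
      calc |B i j - A i j| / Δ i j ≤ ∑ j, |B i j - A i j| / Δ i j :=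
            Finset.single_le_sum (f := fun j => |B i j - A i j| / Δ i j)
              (fun j _ => hq i j) (Finset.mem_univ j)
        _ ≤ _ := Finset.single_le_sum (f := fun i => ∑ j, |B i j - A i j| / Δ i j)
              (fun i _ => Finset.sum_nonneg fun j _ => hq i j) (Finset.mem_univ i)
  rw [abs_le] at hle
  simp only [Matrix.sub_apply, Matrix.add_apply, Matrix.smul_apply, smul_eq_mul, hδ]
  constructor <;> linarith [hle.1, hle.2]

theorem regularityRadius_eq_top_iff {n : ℕ} {A Δ : Matrix (Fin n) (Fin n) ℝ}
    (hΔ : ∀ i j, 0 ≤ Δ i j) :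
    regularityRadius A Δ = ⊤ ↔ ∀ B, AgreesOffSupport A Δ B → B.det ≠ 0 := by
  unfold regularityRadius
  rw [sInf_eq_top]
  constructor
  · intro h B hB hdet
    obtain ⟨δ, hδ⟩ := hB.exists_mem_intervalMatrix hΔ
    exact ENNReal.coe_ne_top (h δ ⟨δ, fun hr => hr B hδ hdet, rfl⟩)
  · rintro h _ ⟨δ, hδ, rfl⟩
    refine absurd (fun B hB => h B fun i j hij => ?_) hδ
    have := hB i j
    simp only [Matrix.sub_apply, Matrix.add_apply, Matrix.smul_apply, hij, smul_zero, sub_zero,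
      add_zero] at this
    exact le_antisymm this.2 this.1

/-- If every row outside `I` can be freely adjusted at a column that does not vanish on the kernel
of the rows in `I`, and this kernel is nonzero, then some compatible matrix is singular. -/
theorem exists_singular_agreesOffSupport {n : ℕ} {A Δ : Matrix (Fin n) (Fin n) ℝ}
    {I : Set (Fin n)}
    (hI : ∀ i ∉ I, ∃ j, Δ i j ≠ 0 ∧ ∃ x ∈ rowKernel A I, x j ≠ 0)
    (hne : ∃ x ∈ rowKernel A I, x ≠ 0) : ∃ B, AgreesOffSupport A Δ B ∧ B.det = 0 := by
  -- A generic kernel vector: finitely many functionals, none of them zero on a space over an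
  -- infinite field, are nonzero at a common vector.
  obtain ⟨x, hx, hxj⟩ := Module.Dual.exists_forall_mem_ne_zero_of_forall_exists (rowKernel A I)
    (fun j : {j : Fin n // ∃ x ∈ rowKernel A I, x j ≠ 0} => LinearMap.proj (R := ℝ) j.1)
    (fun j => j.2)
  have hx0 : x ≠ 0 := by
    obtain ⟨y, hy, hy0⟩ := hne
    obtain ⟨j, hj⟩ := Function.ne_iff.mp hy0
    intro h
    exact hxj ⟨j, y, hy, hj⟩ (by simp [h])
  have hrow : ∀ i, ∃ b : Fin n → ℝ, (∀ j, Δ i j = 0 → b j = A i j) ∧ b ⬝ᵥ x = 0 := by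
    intro i
    by_cases hi : i ∈ I
    · exact ⟨A i, fun _ _ => rfl, hx i hi⟩
    · obtain ⟨j, hj, hj'⟩ := hI i hi
      have hxj' : x j ≠ 0 := hxj ⟨j, hj'⟩
      -- Correcting the single free entry `j` cancels the value `A i ⬝ᵥ x`.
      refine ⟨A i - Pi.single j ((A i ⬝ᵥ x) / x j), fun l hl => ?_, ?_⟩
      · have : l ≠ j := by rintro rfl; exact hj hl
        simp [this]
      · rw [sub_dotProduct, single_dotProduct, div_mul_cancel₀ _ hxj', sub_self]
  choose b hb hbx using hrow
  refine ⟨Matrix.of b, fun i j h => hb i j h, ?_⟩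
  exact Matrix.exists_mulVec_eq_zero_iff.mp ⟨x, hx0, funext hbx⟩

/-- Every null vector of a compatible matrix is annihilated by the rows of `A` in `I`. -/
def CapturesNullVectors {n : ℕ} (A Δ : Matrix (Fin n) (Fin n) ℝ) (I : Set (Fin n)) : Prop :=
  ∀ B, AgreesOffSupport A Δ B → ∀ x, B.mulVec x = 0 → x ∈ rowKernel A I

/-- The criterion shared by the reduction procedure and the program; it holds for singular `A` too.
-/
theorem CapturesNullVectors.regularityRadius_eq_top_iff {n : ℕ}
    {A Δ : Matrix (Fin n) (Fin n) ℝ} (hΔ : ∀ i j, 0 ≤ Δ i j) {I : Set (Fin n)}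
    (h : CapturesNullVectors A Δ I)
    (hI : ∀ i ∉ I, ∃ j, Δ i j ≠ 0 ∧ ∃ x ∈ rowKernel A I, x j ≠ 0) :
    regularityRadius A Δ = ⊤ ↔ ∀ x ∈ rowKernel A I, x = 0 := by
  rw [RegRadius.regularityRadius_eq_top_iff hΔ]
  constructor
  · intro hB
    by_contra! hne
    obtain ⟨B, hB', hdet⟩ := exists_singular_agreesOffSupport hI hne
    exact hB B hB' hdet
  · intro h0 B hB hdet
    obtain ⟨x, hx, hBx⟩ := Matrix.exists_mulVec_eq_zero_iff.mpr hdet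
    exact hx (h0 x (h B hB x hBx))

/-! ### The reduction procedure -/

theorem Stage.clear_rad {n : ℕ} (S : Stage n) (i j k l : Fin n) :
    (S.clear i j).rad k l = if k = i ∧ l = j then 0 else S.rad k l := by
  unfold Stage.clear
  by_cases hk : k = i
  · subst hk
    by_cases hl : l = j <;> simp [hl]
  · simp [hk]

theorem Stage.mem_clear_rows {n : ℕ} (S : Stage n) (i j k : Fin n) :
    k ∈ (S.clear i j).rows ↔ k ∈ S.rows ∨ k = i ∧ ∀ l, (S.clear i j).rad i l = 0 :=
  Iff.rfl

open Classical in
theorem Stage.Step.card_pos_lt {n : ℕ} {A : Matrix (Fin n) (Fin n) ℝ} {S T : Stage n}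
    (h : Stage.Step A S T) :
    (Finset.univ.filter fun p : Fin n × Fin n => 0 < T.rad p.1 p.2).card <
      (Finset.univ.filter fun p : Fin n × Fin n => 0 < S.rad p.1 p.2).card := by
  obtain ⟨i, j, hpos, -⟩ := h
  refine Finset.card_lt_card (Finset.ssubset_iff_of_subset ?_ |>.mpr ⟨(i, j), ?_, ?_⟩)
  · intro p hp
    simp only [Finset.mem_filter, Finset.mem_univ, true_and, Stage.clear_rad] at hp ⊢
    split_ifs at hp with h
    · exact absurd hp (lt_irrefl _)
    · exact hp
  · simpa using hpos
  · simp [Stage.clear_rad]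

-- Each step removes a positive entry, and there are at most `n ^ 2` of them at the start.
open Classical in
theorem Stage.length_le {n : ℕ} {A : Matrix (Fin n) (Fin n) ℝ} (m : ℕ) (S : ℕ → Stage n)
    (hS : ∀ k < m, Stage.Step A (S k) (S (k + 1))) : m ≤ n ^ 2 := by
  have key : ∀ k ≤ m, k +
      (Finset.univ.filter fun p : Fin n × Fin n => 0 < (S k).rad p.1 p.2).card ≤ n ^ 2 := by
    intro k
    induction k with
    | zero =>
      intro _
      refine (zero_add _).le.trans ((Finset.card_filter_le _ _).trans ?_)
      simp [sq]
    | succ k ih =>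
      intro hk
      have h1 := ih (by omega)
      have h2 := (hS k (by omega)).card_pos_lt
      omega
  have := key m le_rfl
  omega

/-- The invariants of the reduction procedure. -/
structure Stage.Invariant {n : ℕ} (A Δ : Matrix (Fin n) (Fin n) ℝ) (S : Stage n) : Prop where
  nonneg : ∀ i j, 0 ≤ S.rad i j
  rad_eq_zero : ∀ i j, Δ i j = 0 → S.rad i j = 0
  mem_rows : ∀ k, k ∈ S.rows ↔ ∀ l, S.rad k l = 0
  -- The products are compared, not the entries: this covers both the entries fixed from the start
  -- (`B i j = A i j`) and those cleared later (`x j = 0`).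
  null : ∀ B, AgreesOffSupport A Δ B → ∀ x, B.mulVec x = 0 →
    ∀ i j, S.rad i j = 0 → B i j * x j = A i j * x j

theorem Stage.Invariant.capturesNullVectors {n : ℕ} {A Δ : Matrix (Fin n) (Fin n) ℝ}
    {S : Stage n} (h : S.Invariant A Δ) : CapturesNullVectors A Δ S.rows := by
  intro B hB x hx k hk
  have h1 : B k ⬝ᵥ x = 0 := congrFun hx k
  rw [← h1]
  refine Finset.sum_congr rfl fun j _ => ?_
  exact (h.null B hB x hx k j ((h.mem_rows k).mp hk j)).symm

theorem Stage.Invariant.initial {n : ℕ} {A Δ : Matrix (Fin n) (Fin n) ℝ}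
    (hΔ : ∀ i j, 0 ≤ Δ i j) : (Stage.initial Δ).Invariant A Δ where
  nonneg := hΔ
  rad_eq_zero _ _ h := h
  mem_rows _ := Iff.rfl
  null B hB x _ i j h := by rw [hB i j h]

theorem Stage.Invariant.step {n : ℕ} {A Δ : Matrix (Fin n) (Fin n) ℝ} {S T : Stage n}
    (h : S.Invariant A Δ) (hST : Stage.Step A S T) : T.Invariant A Δ := by
  obtain ⟨i, j, hpos, hvan⟩ := hST
  refine ⟨fun k l => ?_, fun k l hkl => ?_, fun k => ?_, fun B hB x hx k l hkl => ?_⟩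
  · rw [Stage.clear_rad]
    split_ifs
    exacts [le_rfl, h.nonneg k l]
  · rw [Stage.clear_rad, h.rad_eq_zero k l hkl, ite_self]
  · rw [Stage.mem_clear_rows, h.mem_rows]
    by_cases hk : k = i
    · subst hk
      have : ¬ ∀ l, S.rad k l = 0 := fun h0 => hpos.ne' (h0 j)
      simp [this]
    · simp [hk, Stage.clear_rad]
  · rw [Stage.clear_rad] at hkl
    split_ifs at hkl with hc
    · rw [hc.2, hvan x (h.capturesNullVectors B hB x hx), mul_zero, mul_zero]
    · exact h.null B hB x hx k l hkl

theorem Stage.EndsAt.invariant {n : ℕ} {A Δ : Matrix (Fin n) (Fin n) ℝ}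
    (hΔ : ∀ i j, 0 ≤ Δ i j) {S : Stage n} (h : Stage.EndsAt A Δ S) : S.Invariant A Δ := by
  obtain ⟨h, -⟩ := h
  induction h with
  | refl => exact Stage.Invariant.initial hΔ
  | tail _ hs ih => exact ih.step hs

theorem Stage.EndsAt.regularityRadius_eq_top_iff {n : ℕ} {A Δ : Matrix (Fin n) (Fin n) ℝ}
    (hΔ : ∀ i j, 0 ≤ Δ i j) (hA : A.det ≠ 0) {S : Stage n} (h : Stage.EndsAt A Δ S) :
    regularityRadius A Δ = ⊤ ↔ S.rows = Set.univ := by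
  have hinv := h.invariant hΔ
  -- Since no step is possible, a remaining positive entry stands in a column that does not vanish
  -- on the kernel.
  have hfree : ∀ i ∉ S.rows, ∃ j, Δ i j ≠ 0 ∧ ∃ x ∈ rowKernel A S.rows, x j ≠ 0 := by
    intro i hi
    rw [hinv.mem_rows] at hi
    push Not at hi
    obtain ⟨j, hj⟩ := hi
    refine ⟨j, fun h0 => hj (hinv.rad_eq_zero i j h0), ?_⟩
    by_contra! hv
    exact h.2 _ (Stage.Step.clear S i j (lt_of_le_of_ne (hinv.nonneg i j) (Ne.symm hj)) hv)
  rw [hinv.capturesNullVectors.regularityRadius_eq_top_iff hΔ hfree]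
  constructor
  -- A row outside the index set would supply a nonzero kernel vector. Nonsingularity of `A` enters
  -- only in the converse.
  · intro h0
    by_contra hne
    obtain ⟨i, hi⟩ := (Set.ne_univ_iff_exists_notMem _).mp hne
    obtain ⟨j, -, x, hx, hxj⟩ := hfree i hi
    exact hxj (by simp [h0 x hx])
  · intro hu x hx
    refine Matrix.eq_zero_of_mulVec_eq_zero hA (funext fun k => ?_)
    exact hx k (hu ▸ Set.mem_univ k)

open Matrix

/-! ### Orthogonal projectors onto row kernels -/

/-- `P` is the matrix of the orthogonal projection onto the vectors annihilated by the rows of `A`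
in `I`. -/
structure IsKernelProjector {K : Type} [Field K] {n : ℕ} (A : Matrix (Fin n) (Fin n) K)
    (I : Set (Fin n)) (P : Matrix (Fin n) (Fin n) K) : Prop where
  symm : Pᵀ = P
  ann : ∀ k ∈ I, P *ᵥ A k = 0
  -- Formulated through the row span, which over `ℚ` provides the coefficients needed to bound
  -- denominators.
  compl : ∀ x, x - P *ᵥ x ∈ Submodule.span K (A '' I)

namespace IsKernelProjector

variable {K : Type} [Field K] {n : ℕ} {A P : Matrix (Fin n) (Fin n) K} {I : Set (Fin n)}

theorem dotProduct_comm (h : IsKernelProjector A I P) (x y : Fin n → K) :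
    x ⬝ᵥ P *ᵥ y = P *ᵥ x ⬝ᵥ y := by
  rw [dotProduct_mulVec, ← mulVec_transpose, h.symm]

theorem mulVec_span (h : IsKernelProjector A I P) {x : Fin n → K}
    (hx : x ∈ Submodule.span K (A '' I)) : P *ᵥ x = 0 := by
  have hle : Submodule.span K (A '' I) ≤ LinearMap.ker P.mulVecLin := by
    rw [Submodule.span_le]
    rintro _ ⟨k, hk, rfl⟩
    exact h.ann k hk
  exact hle hx

theorem mulVec_mulVec (h : IsKernelProjector A I P) (x : Fin n → K) :
    P *ᵥ (P *ᵥ x) = P *ᵥ x := by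
  have := h.mulVec_span (h.compl x)
  rw [mulVec_sub, sub_eq_zero] at this
  exact this.symm

theorem dotProduct_self (h : IsKernelProjector A I P) (x : Fin n → K) :
    P *ᵥ x ⬝ᵥ P *ᵥ x = P *ᵥ x ⬝ᵥ x := by
  rw [h.dotProduct_comm, h.mulVec_mulVec]

/-- This is `P = Pᵀ P`. On the diagonal it is a sum of squares, which makes `P j j` nonnegative,
lets `P j j = 0` kill the whole column, and bounds the entries by `1`. -/
theorem apply_eq_sum (h : IsKernelProjector A I P) (i j : Fin n) :
    P i j = ∑ k, P k i * P k j := by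
  have h2 : P *ᵥ (P *ᵥ Pi.single j 1) = P *ᵥ Pi.single j 1 := h.mulVec_mulVec _
  have h3 := congrFun h2 i
  simp only [mulVec_single_one] at h3
  have h4 : ∑ k, P i k * P k j = P i j := h3
  refine h4.symm.trans (Finset.sum_congr rfl fun k _ => ?_)
  rw [show P i k = P k i from congrFun (congrFun h.symm k) i]

theorem empty : IsKernelProjector A ∅ 1 where
  symm := transpose_one
  ann := by simp
  compl := by simp

variable [LinearOrder K] [IsStrictOrderedRing K]

theorem diag_nonneg (h : IsKernelProjector A I P) (j : Fin n) : 0 ≤ P j j := by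
  rw [h.apply_eq_sum]
  exact Finset.sum_nonneg fun k _ => mul_self_nonneg _

theorem apply_eq_zero_of_diag (h : IsKernelProjector A I P) {j : Fin n} (hj : P j j = 0)
    (k : Fin n) : P k j = 0 := by
  rw [h.apply_eq_sum, Finset.sum_eq_zero_iff_of_nonneg fun k _ => mul_self_nonneg _] at hj
  exact mul_self_eq_zero.mp (hj k (Finset.mem_univ k))

theorem abs_apply_le_one (h : IsKernelProjector A I P) (i j : Fin n) : |P i j| ≤ 1 := by
  have h1 : P i j * P i j ≤ P j j := by
    rw [h.apply_eq_sum j j]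
    exact Finset.single_le_sum (f := fun k => P k j * P k j)
      (fun k _ => mul_self_nonneg _) (Finset.mem_univ i)
  have h2 : P j j * P j j ≤ P j j := by
    conv_rhs => rw [h.apply_eq_sum j j]
    exact Finset.single_le_sum (f := fun k => P k j * P k j)
      (fun k _ => mul_self_nonneg _) (Finset.mem_univ j)
  have h3 := h.diag_nonneg j
  have h4 : P j j ≤ 1 := by
    by_contra! hlt
    nlinarith
  rw [abs_le_one_iff_mul_self_le_one]
  exact h1.trans h4

/-- Projecting along one more row. -/
theorem insert (h : IsKernelProjector A I P) (i : Fin n) :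
    IsKernelProjector A (insert i I)
      (P - (P *ᵥ A i ⬝ᵥ P *ᵥ A i)⁻¹ • vecMulVec (P *ᵥ A i) (P *ᵥ A i)) := by
  set v := P *ᵥ A i with hv
  have hmul : ∀ x, (P - (v ⬝ᵥ v)⁻¹ • vecMulVec v v) *ᵥ x =
      P *ᵥ x - ((v ⬝ᵥ v)⁻¹ * (v ⬝ᵥ x)) • v := by
    intro x
    rw [sub_mulVec, smul_mulVec, vecMulVec_mulVec, ← smul_smul]
    congr 2
    funext k
    simp [mul_comm]
  have hsub : Submodule.span K (A '' I) ≤ Submodule.span K (A '' Insert.insert i I) :=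
    Submodule.span_mono (Set.image_mono (Set.subset_insert i I))
  refine ⟨?_, ?_, fun x => ?_⟩
  · rw [transpose_sub, transpose_smul, transpose_vecMulVec, h.symm]
  · intro k hk
    rw [hmul]
    rcases Set.mem_insert_iff.mp hk with rfl | hk
    · rw [← h.dotProduct_self]
      -- If `v = 0`, the row already lies in the span, and `0⁻¹ = 0` leaves the projector unchanged,
      -- as it should.
      by_cases h0 : v ⬝ᵥ v = 0
      · rw [← hv, dotProduct_self_eq_zero.mp h0]
        simp
      · rw [← hv, inv_mul_cancel₀ h0, one_smul, sub_self]
    · have hvk : v ⬝ᵥ A k = 0 := by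
        change P *ᵥ A i ⬝ᵥ A k = 0
        rw [← h.dotProduct_comm, h.ann k hk, dotProduct_zero]
      rw [h.ann k hk, hvk]
      simp
  · rw [hmul, sub_sub_eq_add_sub, add_sub_right_comm]
    refine add_mem (hsub (h.compl x)) (Submodule.smul_mem _ _ ?_)
    have h1 : v = A i - (A i - P *ᵥ A i) := by rw [sub_sub_cancel]
    rw [h1]
    exact sub_mem (Submodule.subset_span ⟨i, Set.mem_insert _ _, rfl⟩) (hsub (h.compl _))

end IsKernelProjector

/-- A kernel vector `x` is fixed by `P`, because `x - P x` lies in the row span and is orthogonal to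
it. If `P j j = 0`, row `j` of `P` is zero. -/
theorem IsKernelProjector.apply_eq_zero {n : ℕ} {A P : Matrix (Fin n) (Fin n) ℝ}
    {I : Set (Fin n)} (h : IsKernelProjector A I P) {x : Fin n → ℝ} (hx : x ∈ rowKernel A I)
    {j : Fin n} (hj : P j j = 0) : x j = 0 := by
  have hPx : P *ᵥ x = x := by
    have hd : (x - P *ᵥ x) ⬝ᵥ (x - P *ᵥ x) = 0 := by
      -- The functional `y ↦ y ⬝ᵥ (x - P x)`, encoded as multiplication by a one-column matrix.
      have hle : Submodule.span ℝ (A '' I) ≤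
          LinearMap.ker (Matrix.vecMulLinear (Matrix.of fun (k : Fin n) (_ : Unit) =>
            (x - P *ᵥ x) k)) := by
        rw [Submodule.span_le]
        rintro _ ⟨k, hk, rfl⟩
        refine funext fun _ => ?_
        change A k ⬝ᵥ (x - P *ᵥ x) = 0
        rw [dotProduct_sub, hx k hk, h.dotProduct_comm, h.ann k hk, zero_dotProduct, sub_zero]
      exact congrFun (hle (h.compl x)) ()
    exact (sub_eq_zero.mp (dotProduct_self_eq_zero.mp hd)).symm
  rw [← hPx]
  change ∑ k, P j k * x k = 0
  refine Finset.sum_eq_zero fun k _ => ?_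
  rw [show P j k = P k j from congrFun (congrFun h.symm k) j, h.apply_eq_zero_of_diag hj, zero_mul]

theorem IsKernelProjector.col_mem {n : ℕ} {A P : Matrix (Fin n) (Fin n) ℝ}
    {I : Set (Fin n)} (h : IsKernelProjector A I P) (j : Fin n) :
    P *ᵥ Pi.single j 1 ∈ rowKernel A I := by
  intro k hk
  rw [h.dotProduct_comm, h.ann k hk, zero_dotProduct]

/-! ### The algorithm on matrices -/

/-- The rows processed so far, and the projector onto the vectors they annihilate. -/
@[ext]
structure ProjState (K : Type) (n : ℕ) where
  rows : Finset (Fin n)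
  proj : Matrix (Fin n) (Fin n) K

namespace ProjState

variable {K : Type} [Field K] [LinearOrder K] {n : ℕ}

/-- Process row `i`, provided that it has no free entry in a column that survives. -/
def step (A Δ : Matrix (Fin n) (Fin n) K) (i : Fin n) (s : ProjState K n) : ProjState K n :=
  -- For nonnegative `Δ` all terms are nonnegative, so a single comparison tests that they all
  -- vanish.
  if ∑ j, Δ i j * s.proj j j ≤ 0 then
    ⟨insert i s.rows, Matrix.of fun j k =>
      s.proj j k - (s.proj *ᵥ A i) j * (s.proj *ᵥ A i) k / (s.proj *ᵥ A i ⬝ᵥ s.proj *ᵥ A i)⟩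
  else s

/-- Process the rows below `m`. -/
def sweep (A Δ : Matrix (Fin n) (Fin n) K) : ℕ → ProjState K n → ProjState K n
  | 0, s => s
  | m + 1, s => if h : m < n then step A Δ ⟨m, h⟩ (sweep A Δ m s) else sweep A Δ m s

/-- The state after `m` rounds. -/
def rounds (A Δ : Matrix (Fin n) (Fin n) K) : ℕ → ProjState K n
  | 0 => ⟨∅, 1⟩
  | m + 1 => sweep A Δ n (rounds A Δ m)

/-- The final test. -/
def Accepts (A Δ : Matrix (Fin n) (Fin n) K) : Prop :=
  ∑ j, (rounds A Δ n).proj j j ≤ 0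

/-- The projector belongs to the rows. -/
def Valid (A : Matrix (Fin n) (Fin n) K) (s : ProjState K n) : Prop :=
  IsKernelProjector A (s.rows : Set (Fin n)) s.proj

/-! ### Stabilisation of the sweeps -/

variable {A Δ : Matrix (Fin n) (Fin n) K} {s : ProjState K n}

theorem sweep_induction {p : ProjState K n → Prop} (hstep : ∀ i s, p s → p (step A Δ i s))
    (hs : p s) (m : ℕ) : p (sweep A Δ m s) := by
  induction m with
  | zero => exact hs
  | succ m ih =>
    unfold sweep
    split_ifs
    exacts [hstep _ _ ih, ih]

theorem rounds_induction {p : ProjState K n → Prop} (hstep : ∀ i s, p s → p (step A Δ i s))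
    (h0 : p ⟨∅, 1⟩) (m : ℕ) : p (rounds A Δ m) := by
  induction m with
  | zero => exact h0
  | succ m ih => exact sweep_induction hstep ih n

theorem subset_step (i : Fin n) : s.rows ⊆ (step A Δ i s).rows := by
  unfold step
  split_ifs
  exacts [Finset.subset_insert _ _, subset_rfl]

theorem subset_sweep_add (m k : ℕ) : (sweep A Δ m s).rows ⊆ (sweep A Δ (m + k) s).rows := by
  induction k with
  | zero => exact subset_rfl
  | succ k ih =>
    refine ih.trans ?_
    rw [← add_assoc]
    conv_rhs => unfold sweep
    split_ifs
    exacts [subset_step _, subset_rfl]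

theorem Valid.step [IsStrictOrderedRing K] (h : s.Valid A) (i : Fin n) : (step A Δ i s).Valid A := by
  unfold ProjState.step
  split_ifs
  · have := IsKernelProjector.insert h i
    unfold Valid
    rw [Finset.coe_insert]
    convert this using 1
    ext j k
    simp [vecMulVec_apply, div_eq_inv_mul]
  · exact h

theorem Valid.sweep [IsStrictOrderedRing K] (h : s.Valid A) (m : ℕ) : (sweep A Δ m s).Valid A :=
  sweep_induction (fun i _ hs => hs.step i) h m

theorem valid_rounds [IsStrictOrderedRing K] (m : ℕ) : (rounds A Δ m).Valid A :=
  rounds_induction (fun i _ hs => hs.step i) (by simpa [Valid] using IsKernelProjector.empty) m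

/-- For a row already processed `P A i = 0`, and the update subtracts `0 / 0 = 0`. Hence the program
need not remember which rows it has processed. -/
theorem Valid.step_eq_self (h : s.Valid A) {i : Fin n}
    (hi : (ProjState.step A Δ i s).rows ⊆ s.rows) :
    ProjState.step A Δ i s = s := by
  unfold ProjState.step at hi ⊢
  split_ifs with hc
  · rw [if_pos hc] at hi
    have his : i ∈ s.rows := hi (Finset.mem_insert_self _ _)
    have h0 : s.proj *ᵥ A i = 0 := h.ann i his
    ext1
    · exact Finset.insert_eq_of_mem his
    · ext j k
      simp [h0]
  · rfl

/-- No unprocessed row can be processed. -/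
def Closed (Δ : Matrix (Fin n) (Fin n) K) (s : ProjState K n) : Prop :=
  ∀ i, ∑ j, Δ i j * s.proj j j ≤ 0 → i ∈ s.rows

/-- The row sets increase along a sweep, so if the whole sweep adds nothing, no single step does. -/
theorem Valid.sweep_eq_self (h : s.Valid A) (hs : (ProjState.sweep A Δ n s).rows ⊆ s.rows) :
    ∀ m ≤ n, ProjState.sweep A Δ m s = s := by
  intro m
  induction m with
  | zero => intro _; rfl
  | succ m ih =>
    intro hm
    have hm' : m < n := hm
    have hsub : (ProjState.sweep A Δ (m + 1) s).rows ⊆ s.rows := by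
      refine subset_trans ?_ hs
      have := subset_sweep_add (A := A) (Δ := Δ) (s := s) (m + 1) (n - (m + 1))
      rwa [Nat.add_sub_cancel' hm] at this
    have heq : ProjState.sweep A Δ (m + 1) s = ProjState.step A Δ ⟨m, hm'⟩ s := by
      conv_lhs => unfold ProjState.sweep
      rw [dif_pos hm', ih hm'.le]
    rw [heq] at hsub ⊢
    exact h.step_eq_self hsub

theorem Valid.closed [IsStrictOrderedRing K] (h : s.Valid A) (hs : (ProjState.sweep A Δ n s).rows ⊆ s.rows) :
    s.Closed Δ := by
  intro i hi
  have h1 := h.sweep_eq_self hs (i + 1) i.2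
  have h2 := h.sweep_eq_self hs i i.2.le
  unfold ProjState.sweep at h1
  rw [dif_pos i.2, h2] at h1
  rw [← h1]
  unfold ProjState.step
  rw [if_pos hi]
  exact Finset.mem_insert_self _ _

theorem closed_rounds [IsStrictOrderedRing K] : (rounds A Δ n).Closed Δ := by
  -- Either the process has become stationary, or each round so far has added a row. After `n`
  -- rounds the second case leaves no row unprocessed.
  have key : ∀ m, (rounds A Δ m).Closed Δ ∧ rounds A Δ (m + 1) = rounds A Δ m ∨
      m ≤ (rounds A Δ m).rows.card := by
    intro m
    induction m with
    | zero => exact Or.inr (Nat.zero_le _)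
    | succ m ih =>
      have hr : rounds A Δ (m + 1) = sweep A Δ n (rounds A Δ m) := rfl
      by_cases hs : (sweep A Δ n (rounds A Δ m)).rows ⊆ (rounds A Δ m).rows
      · have heq : rounds A Δ (m + 1) = rounds A Δ m :=
          (valid_rounds m).sweep_eq_self hs n le_rfl
        left
        refine ⟨heq ▸ (valid_rounds m).closed hs, ?_⟩
        change sweep A Δ n (rounds A Δ (m + 1)) = _
        rw [heq, ← hr, heq]
      · right
        rcases ih with ⟨-, heq⟩ | ih
        · rw [← hr, heq] at hs
          exact absurd subset_rfl hs
        · have hsub : (rounds A Δ m).rows ⊆ (rounds A Δ (m + 1)).rows := by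
            have := subset_sweep_add (A := A) (Δ := Δ) (s := rounds A Δ m) 0 n
            rwa [zero_add] at this
          have := Finset.card_lt_card (ssubset_iff_subset_not_subset.mpr ⟨hsub, hs⟩)
          omega
  rcases key n with h | h
  · exact h.1
  · intro i _
    have : (rounds A Δ n).rows = Finset.univ := by
      rw [← Finset.card_eq_iff_eq_univ, Fintype.card_fin]
      exact le_antisymm (by simpa using Finset.card_le_univ (rounds A Δ n).rows) h
    rw [this]
    exact Finset.mem_univ i

theorem Valid.weighted_sum_nonpos_iff [IsStrictOrderedRing K] (h : s.Valid A)
    (hΔ : ∀ i j, 0 ≤ Δ i j) (i : Fin n) :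
    ∑ j, Δ i j * s.proj j j ≤ 0 ↔ ∀ j, Δ i j = 0 ∨ s.proj j j = 0 := by
  have hnn : ∀ j, 0 ≤ Δ i j * s.proj j j := fun j => mul_nonneg (hΔ i j) (h.diag_nonneg j)
  constructor
  · intro hle j
    have h0 := le_antisymm hle (Finset.sum_nonneg fun j _ => hnn j)
    rw [Finset.sum_eq_zero_iff_of_nonneg fun j _ => hnn j] at h0
    exact mul_eq_zero.mp (h0 j (Finset.mem_univ j))
  · intro hz
    exact (Finset.sum_eq_zero fun j _ => mul_eq_zero.mpr (hz j)).le

/-! #### Compatibility with field embeddings -/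

/-- Apply a map to the entries of the projector. -/
def map {L : Type} (f : K → L) (s : ProjState K n) : ProjState L n := ⟨s.rows, s.proj.map f⟩

section Map

variable {L : Type} [Field L] [LinearOrder L] (f : K →+* L)

/-- A step consists of field operations and one comparison with zero, all preserved by an ordered
embedding. So the run over `ℚ` mirrors the run over `ℝ`. -/
theorem step_map (hf : StrictMono f) (i : Fin n) (s : ProjState K n) :
    step (A.map f) (Δ.map f) i (s.map f) = (step A Δ i s).map f := by
  have hc : ∑ j, Δ.map f i j * (s.map f).proj j j ≤ 0 ↔ ∑ j, Δ i j * s.proj j j ≤ 0 := by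
    rw [← hf.le_iff_le, map_zero, map_sum]
    simp [map]
  have hv : (s.map f).proj *ᵥ A.map f i = f ∘ (s.proj *ᵥ A i) := by
    funext j
    simp [map, mulVec, dotProduct]
  unfold step
  by_cases h : ∑ j, Δ i j * s.proj j j ≤ 0
  · rw [if_pos h, if_pos (hc.mpr h), hv]
    ext1
    · rfl
    · ext j k
      simp [map, dotProduct]
  · rw [if_neg h, if_neg (mt hc.mp h)]

theorem sweep_map (hf : StrictMono f) (m : ℕ) (s : ProjState K n) :
    sweep (A.map f) (Δ.map f) m (s.map f) = (sweep A Δ m s).map f := by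
  induction m with
  | zero => rfl
  | succ m ih =>
    unfold sweep
    split_ifs
    · rw [ih, step_map f hf]
    · exact ih

theorem rounds_map (hf : StrictMono f) (m : ℕ) :
    rounds (A.map f) (Δ.map f) m = (rounds A Δ m).map f := by
  induction m with
  | zero => simp [rounds, map]
  | succ m ih =>
    unfold rounds
    rw [ih, sweep_map f hf]

theorem accepts_map (hf : StrictMono f) : Accepts (A.map f) (Δ.map f) ↔ Accepts A Δ := by
  unfold Accepts
  rw [rounds_map f hf, ← hf.le_iff_le, map_zero, map_sum]
  rfl

end Map

end ProjState

/-! ### Correctness of the algorithm over the reals -/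

theorem ProjState.capturesNullVectors_rounds {n : ℕ} {A Δ : Matrix (Fin n) (Fin n) ℝ}
    (hΔ : ∀ i j, 0 ≤ Δ i j) (m : ℕ) :
    CapturesNullVectors A Δ ((rounds A Δ m).rows : Set (Fin n)) := by
  refine (rounds_induction (A := A) (Δ := Δ)
    (p := fun s => s.Valid A ∧ CapturesNullVectors A Δ (s.rows : Set (Fin n)))
    (fun i s hs => ⟨hs.1.step i, ?_⟩) ⟨valid_rounds (Δ := Δ) 0, ?_⟩ m).2
  · unfold step
    split_ifs with hc
    · rw [hs.1.weighted_sum_nonpos_iff hΔ] at hc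
      intro B hB x hx k hk
      have hxs := hs.2 B hB x hx
      rcases Finset.mem_insert.mp (Finset.mem_coe.mp hk) with rfl | hk
      · have h1 : B k ⬝ᵥ x = 0 := congrFun hx k
        rw [← h1]
        refine Finset.sum_congr rfl fun j _ => ?_
        -- Either the entry is fixed, or its column vanishes on the current kernel, which contains
        -- `x`.
        rcases hc j with h | h
        · rw [hB k j h]
        · rw [IsKernelProjector.apply_eq_zero hs.1 hxs h, mul_zero, mul_zero]
      · exact hxs k hk
    · exact hs.2
  · intro B _ x _ k hk
    simp at hk

theorem ProjState.regularityRadius_eq_top_iff {n : ℕ} {A Δ : Matrix (Fin n) (Fin n) ℝ}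
    (hΔ : ∀ i j, 0 ≤ Δ i j) : regularityRadius A Δ = ⊤ ↔ Accepts A Δ := by
  have hv : (rounds A Δ n).Valid A := valid_rounds n
  have hcol : ∀ j, (rounds A Δ n).proj j j ≠ 0 →
      ∃ x ∈ rowKernel A ((rounds A Δ n).rows : Set (Fin n)), x j ≠ 0 := fun j hj =>
    ⟨_, IsKernelProjector.col_mem hv j, by simpa [mulVec_single_one] using hj⟩
  rw [(capturesNullVectors_rounds hΔ n).regularityRadius_eq_top_iff hΔ]
  · have hd : Accepts A Δ ↔ ∀ j, (rounds A Δ n).proj j j = 0 := by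
      unfold Accepts
      have hnn : ∀ j ∈ Finset.univ, 0 ≤ (rounds A Δ n).proj j j := fun j _ =>
        IsKernelProjector.diag_nonneg hv j
      rw [(Finset.sum_nonneg hnn).ge_iff_eq', Finset.sum_eq_zero_iff_of_nonneg hnn]
      simp
    rw [hd]
    constructor
    · intro h j
      by_contra hj
      obtain ⟨x, hx, hxj⟩ := hcol j hj
      exact hxj (by simp [h x hx])
    · intro h x hx
      exact funext fun j => IsKernelProjector.apply_eq_zero hv hx (h j)
  · intro i hi
    have := mt (closed_rounds (A := A) (Δ := Δ) i) hi
    rw [hv.weighted_sum_nonpos_iff hΔ] at this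
    push Not at this
    obtain ⟨j, hj, hj'⟩ := this
    exact ⟨j, hj, hcol j hj'⟩

/-! ### Bit length of rational numbers -/

/-- The absolute value of `q` and some denominator of `q` are at most `2 ^ b`. -/
def BitBounded (b : ℕ) (q : ℚ) : Prop :=
  |q| ≤ 2 ^ b ∧ ∃ d : ℤ, d ≠ 0 ∧ |d| ≤ 2 ^ b ∧ ∃ z : ℤ, (d : ℚ) * q = z

/-- A family of predicates bounding the size of the elements of a field, with the rules that the
bit length obeys, up to constant factors. -/
structure IsSizeBound {K : Type} [Field K] (w : K → ℕ) (Bd : ℕ → K → Prop) : Prop where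
  mono : ∀ {b c x}, b ≤ c → Bd b x → Bd c x
  zero : Bd 0 0
  one : Bd 0 1
  add : ∀ {b c x y}, Bd b x → Bd c y → Bd (b + c + 1) (x + y)
  sub : ∀ {b c x y}, Bd b x → Bd c y → Bd (b + c + 1) (x - y)
  mul : ∀ {b c x y}, Bd b x → Bd c y → Bd (b + c) (x * y)
  div : ∀ {b c x y}, Bd b x → Bd c y → Bd (b + 2 * c) (x / y)
  weight_le : ∀ {b x}, Bd b x → w x ≤ 3 * b + 3

theorem IsSizeBound.sum_range {K : Type} [Field K] {w : K → ℕ} {Bd : ℕ → K → Prop}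
    (h : IsSizeBound w Bd) {f : ℕ → K} {b m : ℕ} (hf : ∀ k < m, Bd b (f k)) :
    Bd (m * (b + 1)) (∑ k ∈ Finset.range m, f k) := by
  induction m with
  | zero => simpa using h.zero
  | succ m ih =>
    rw [Finset.sum_range_succ]
    refine h.mono (by ring_nf; omega) (h.add (ih fun k hk => hf k (by omega)) (hf m (by omega)))

/-- The unit cost model: everything has size `0`. -/
theorem isSizeBound_trivial {K : Type} [Field K] :
    IsSizeBound (fun _ : K => 0) (fun _ _ => True) := by
  constructor <;> simp

theorem BitBounded.mono {b c : ℕ} {q : ℚ} (hbc : b ≤ c) (h : BitBounded b q) :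
    BitBounded c q := by
  obtain ⟨hq, d, hd, hdb, hz⟩ := h
  exact ⟨hq.trans (pow_le_pow_right₀ one_le_two hbc), d, hd,
    hdb.trans (pow_le_pow_right₀ one_le_two hbc), hz⟩

theorem BitBounded.neg {b : ℕ} {q : ℚ} (h : BitBounded b q) : BitBounded b (-q) := by
  obtain ⟨hq, d, hd, hdb, z, hz⟩ := h
  exact ⟨by rwa [abs_neg], d, hd, hdb, -z, by push_cast; rw [← hz]; ring⟩

theorem BitBounded.add {b c : ℕ} {p q : ℚ} (hp : BitBounded b p) (hq : BitBounded c q) :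
    BitBounded (b + c + 1) (p + q) := by
  obtain ⟨hp, d, hd, hdb, z, hz⟩ := hp
  obtain ⟨hq, e, he, heb, y, hy⟩ := hq
  have h1 : (1 : ℚ) ≤ 2 ^ b := one_le_pow₀ one_le_two
  have h2 : (1 : ℚ) ≤ 2 ^ c := one_le_pow₀ one_le_two
  refine ⟨(abs_add_le p q).trans ?_, d * e, mul_ne_zero hd he, ?_, e * z + d * y, ?_⟩
  · rw [pow_succ, pow_add]
    nlinarith
  · rw [abs_mul, pow_succ, pow_add]
    have := mul_le_mul hdb heb (abs_nonneg e) (by positivity)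
    have : (0 : ℤ) < 2 ^ b * 2 ^ c := by positivity
    omega
  · push_cast
    rw [← hz, ← hy]
    ring

theorem BitBounded.mul {b c : ℕ} {p q : ℚ} (hp : BitBounded b p) (hq : BitBounded c q) :
    BitBounded (b + c) (p * q) := by
  obtain ⟨hp, d, hd, hdb, z, hz⟩ := hp
  obtain ⟨hq, e, he, heb, y, hy⟩ := hq
  refine ⟨?_, d * e, mul_ne_zero hd he, ?_, z * y, ?_⟩
  · rw [abs_mul, pow_add]
    exact mul_le_mul hp hq (abs_nonneg q) (by positivity)
  · rw [abs_mul, pow_add]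
    exact mul_le_mul hdb heb (abs_nonneg e) (by positivity)
  · push_cast
    rw [← hz, ← hy]
    ring

/-- `BitBounded` admits any denominator, which avoids reducing fractions in the arithmetic rules;
the reduced denominator divides it. -/
theorem BitBounded.den_le {b : ℕ} {q : ℚ} (h : BitBounded b q) : q.den ≤ 2 ^ b := by
  obtain ⟨-, d, hd, hdb, z, hz⟩ := h
  have hd' : (d : ℚ) ≠ 0 := by exact_mod_cast hd
  have hq : q = Rat.divInt z d := by rw [Rat.divInt_eq_div, ← hz]; field_simp
  have hdvd : (q.den : ℤ) ∣ d := hq ▸ Rat.den_dvd z d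
  have := Int.le_of_dvd (abs_pos.mpr hd) ((dvd_abs _ _).mpr hdvd)
  exact_mod_cast this.trans hdb

theorem BitBounded.natAbs_num_le {b : ℕ} {q : ℚ} (h : BitBounded b q) :
    q.num.natAbs ≤ 2 ^ (2 * b) := by
  have hden : (q.den : ℚ) ≤ 2 ^ b := by exact_mod_cast h.den_le
  have h1 : ((q.num.natAbs : ℕ) : ℚ) = |q| * q.den := by
    conv_rhs => rw [← Rat.num_div_den q]
    have hpos : (0 : ℚ) < q.den := by exact_mod_cast q.den_pos
    rw [abs_div, abs_of_pos hpos, Rat.num_div_den q, div_mul_cancel₀ _ hpos.ne', Nat.cast_natAbs,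
      Int.cast_abs]
  have h2 : ((q.num.natAbs : ℕ) : ℚ) ≤ 2 ^ (2 * b) := by
    rw [h1, two_mul, pow_add]
    exact mul_le_mul h.1 hden (by positivity) (by positivity)
  exact_mod_cast h2

/-- The numerator becomes a denominator. It is at most `|q|` times the denominator of `q`, hence the
factor `2`. -/
theorem BitBounded.inv {b : ℕ} {q : ℚ} (h : BitBounded b q) : BitBounded (2 * b) q⁻¹ := by
  by_cases h0 : q = 0
  · subst h0
    refine ⟨by simp, 1, one_ne_zero, ?_, 0, by simp⟩
    rw [abs_one]
    exact one_le_pow₀ one_le_two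
  · have hnum : q.num ≠ 0 := Rat.num_ne_zero.mpr h0
    have hden : (q.den : ℚ) ≤ 2 ^ b := by exact_mod_cast h.den_le
    have hnum1 : (1 : ℚ) ≤ |(q.num : ℚ)| := by exact_mod_cast Int.one_le_abs hnum
    have hmul : (q.num : ℚ) * q⁻¹ = q.den := by
      have h1 : q⁻¹ = q.den / q.num := by
        conv_lhs => rw [← Rat.num_div_den q, inv_div]
      rw [h1, mul_div_cancel₀]
      exact_mod_cast hnum
    refine ⟨?_, q.num, hnum, ?_, q.den, by exact_mod_cast hmul⟩
    · calc |q⁻¹| ≤ |(q.num : ℚ)| * |q⁻¹| := le_mul_of_one_le_left (abs_nonneg _) hnum1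
        _ = q.den := by rw [← abs_mul, hmul]; exact abs_of_nonneg (by positivity)
        _ ≤ 2 ^ b := hden
        _ ≤ 2 ^ (2 * b) := pow_le_pow_right₀ one_le_two (by omega)
    · rw [Int.abs_eq_natAbs]
      exact_mod_cast h.natAbs_num_le

theorem BitBounded.ratBits_le {b : ℕ} {q : ℚ} (h : BitBounded b q) : ratBits q ≤ 3 * b + 3 := by
  have h1 : Nat.size q.num.natAbs ≤ 2 * b + 1 :=
    Nat.size_le.mpr (h.natAbs_num_le.trans_lt (Nat.pow_lt_pow_right one_lt_two (by omega)))
  have h2 : Nat.size q.den ≤ b + 1 :=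
    Nat.size_le.mpr (h.den_le.trans_lt (Nat.pow_lt_pow_right one_lt_two (by omega)))
  unfold ratBits
  omega

theorem isSizeBound_ratBits : IsSizeBound ratBits BitBounded where
  mono := BitBounded.mono
  zero := ⟨by simp, 1, one_ne_zero, by simp, 0, by simp⟩
  one := ⟨by simp, 1, one_ne_zero, by simp, 1, by simp⟩
  add := BitBounded.add
  sub hx hy := by rw [sub_eq_add_neg]; exact hx.add hy.neg
  mul := BitBounded.mul
  div hx hy := by rw [div_eq_mul_inv]; exact hx.mul hy.inv
  weight_le := BitBounded.ratBits_le

theorem den_le_two_pow_ratBits (q : ℚ) : q.den ≤ 2 ^ ratBits q :=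
  (Nat.lt_size_self _).le.trans (Nat.pow_le_pow_right two_pos (by unfold ratBits; omega))

theorem abs_le_two_pow_ratBits (q : ℚ) : |q| ≤ 2 ^ ratBits q := by
  have h1 : q.num.natAbs ≤ 2 ^ ratBits q :=
    (Nat.lt_size_self _).le.trans (Nat.pow_le_pow_right two_pos (by unfold ratBits; omega))
  have h2 : |q| ≤ (q.num.natAbs : ℚ) := by
    conv_lhs => rw [← Rat.num_div_den q]
    have hpos : (1 : ℚ) ≤ q.den := by exact_mod_cast q.den_pos
    rw [abs_div, Nat.cast_natAbs, Int.cast_abs, abs_of_nonneg (zero_le_one.trans hpos)]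
    exact div_le_self (abs_nonneg _) hpos
  exact h2.trans (by exact_mod_cast h1)

theorem bitBounded_of_ratBits_le {q : ℚ} {b : ℕ} (h : ratBits q ≤ b) : BitBounded b q := by
  refine BitBounded.mono h ⟨abs_le_two_pow_ratBits q, q.den, by exact_mod_cast q.den_ne_zero, ?_,
    q.num, ?_⟩
  · rw [abs_of_nonneg (by positivity)]
    exact_mod_cast den_le_two_pow_ratBits q
  · exact_mod_cast Rat.den_mul_eq_num q

/-! ### The bit length of a projector -/

/-- The projector has a common denominator of the form `det (M Mᵀ)`, where the rows of `M` are
some of the rows of an integral multiple of `A`. -/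
theorem IsKernelProjector.exists_common_denominator {n : ℕ} {A P : Matrix (Fin n) (Fin n) ℚ}
    {I : Set (Fin n)} (h : IsKernelProjector A I P) {D : ℤ} (hD : D ≠ 0)
    {Z : Matrix (Fin n) (Fin n) ℤ} (hZ : ∀ i j, (D : ℚ) * A i j = Z i j) :
    ∃ (t : ℕ) (M : Matrix (Fin t) (Fin n) ℤ), t ≤ n ∧ (∀ x j, ∃ i, M x j = Z i j) ∧
      (M * Mᵀ).det ≠ 0 ∧ ∀ i j, ∃ z : ℤ, ((M * Mᵀ).det : ℚ) * P i j = z := by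
  classical
  have hDQ : (D : ℚ) ≠ 0 := by exact_mod_cast hD
  obtain ⟨b, hb, hspan, hli⟩ := exists_linearIndependent ℚ (A '' I)
  have hfin : b.Finite := ((Set.toFinite I).image A).subset hb
  have := hfin.fintype
  obtain ⟨t, ⟨e⟩⟩ : ∃ t, Nonempty (Fin t ≃ b) := ⟨_, ⟨(Fintype.equivFin b).symm⟩⟩
  have hidx : ∀ x : Fin t, ∃ i, i ∈ I ∧ A i = (e x : Fin n → ℚ) := fun x => hb (e x).2
  choose idx hidxI hidx using hidx
  have hli' : LinearIndependent ℚ fun x : Fin t => (e x : Fin n → ℚ) := hli.comp e e.injective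
  have hrange : Set.range (fun x : Fin t => (e x : Fin n → ℚ)) = b := by
    rw [show (fun x : Fin t => (e x : Fin n → ℚ)) = Subtype.val ∘ e from rfl, Set.range_comp,
      e.surjective.range_eq, Set.image_univ, Subtype.range_coe]
  have ht : t ≤ n := by simpa using hli'.fintype_card_le_finrank
  let MZ : Matrix (Fin t) (Fin n) ℤ := Matrix.of fun x j => Z (idx x) j
  set M : Matrix (Fin t) (Fin n) ℚ := MZ.map (Int.castRingHom ℚ) with hM
  have hMx : ∀ x j, M x j = D * (e x : Fin n → ℚ) j := by
    intro x j
    rw [← hidx x, hZ]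
    rfl
  have hMP : M * P = 0 := by
    ext x j
    have h0 : (P *ᵥ A (idx x)) j = 0 := by rw [h.ann _ (hidxI x)]; rfl
    rw [mul_apply, Matrix.zero_apply, ← mul_zero (D : ℚ), ← h0]
    simp only [mulVec, dotProduct, Finset.mul_sum]
    refine Finset.sum_congr rfl fun k _ => ?_
    rw [hMx, ← hidx, show P k j = P j k from congrFun (congrFun h.symm j) k]
    ring
  have hcol : ∀ j, ∃ c : Fin t → ℚ, ∑ x, c x • (e x : Fin n → ℚ) =
      Pi.single j 1 - P *ᵥ Pi.single j 1 := by
    intro j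
    have := h.compl (Pi.single j 1)
    rw [← hspan, ← hrange] at this
    exact (Submodule.mem_span_range_iff_exists_fun ℚ).mp this
  choose c hc using hcol
  let C : Matrix (Fin t) (Fin n) ℚ := Matrix.of fun x j => c j x / D
  have hC : 1 - P = Mᵀ * C := by
    ext i j
    have := congrFun (hc j) i
    simp only [Finset.sum_apply, Pi.smul_apply, smul_eq_mul, Pi.sub_apply, mulVec_single_one]
      at this
    rw [Matrix.sub_apply, one_apply, mul_apply]
    rw [Pi.single_apply] at this
    refine this.symm.trans (Finset.sum_congr rfl fun x _ => ?_)
    simp only [transpose_apply, hMx, C, of_apply]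
    field_simp
  set G := M * Mᵀ with hG
  have hGmap : G = (MZ * MZᵀ).map (Int.castRingHom ℚ) := by rw [Matrix.map_mul, transpose_map]
  have hdet : G.det = ((MZ * MZᵀ).det : ℤ) := by
    rw [hGmap]
    exact (RingHom.map_det _ _).symm
  -- The Gram matrix of linearly independent rows is nonsingular: `G z = 0` gives `Mᵀ z ⬝ᵥ Mᵀ z =
  -- 0`.
  have hGdet : G.det ≠ 0 := by
    intro h0
    obtain ⟨z, hz, hGz⟩ := Matrix.exists_mulVec_eq_zero_iff.mpr h0
    have h1 : Mᵀ *ᵥ z ⬝ᵥ Mᵀ *ᵥ z = 0 := by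
      rw [mulVec_transpose, ← dotProduct_mulVec, ← mulVec_transpose,
        Matrix.mulVec_mulVec, ← hG, hGz,
        dotProduct_zero]
    have h2 := dotProduct_self_eq_zero.mp h1
    have h3 : ∑ x, z x • (e x : Fin n → ℚ) = 0 := by
      funext j
      have := congrFun h2 j
      simp only [mulVec, dotProduct, transpose_apply, hMx, Pi.zero_apply] at this
      have h4 : (D : ℚ) * ∑ x, z x * (e x : Fin n → ℚ) j = 0 := by
        rw [Finset.mul_sum, ← this]
        exact Finset.sum_congr rfl fun x _ => by ring
      simpa using (mul_eq_zero.mp h4).resolve_left hDQ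
    exact hz (funext fun x => Fintype.linearIndependent_iff.mp hli' z h3 x)
  have hGC : M = G * C := by
    have : M * (1 - P) = M := by rw [Matrix.mul_sub, hMP, Matrix.mul_one, sub_zero]
    rw [← this, hC, ← Matrix.mul_assoc]
  -- Multiplying `M = G C` by the adjugate gives `det G • C = adj G * M`, so `det G • (1 - P) = Mᵀ *
  -- adj G * M` is integral.
  have hfinal : G.det • (1 - P) = (MZᵀ * ((MZ * MZᵀ).adjugate * MZ)).map (Int.castRingHom ℚ) := by
    have hGadj : G.adjugate = (MZ * MZᵀ).adjugate.map (Int.castRingHom ℚ) := by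
      rw [hGmap]
      exact (RingHom.map_adjugate _ _).symm
    have h1 : G.adjugate * M = G.det • C := by
      conv_lhs => rw [hGC, ← Matrix.mul_assoc, adjugate_mul]
      simp
    rw [hC, ← Matrix.mul_smul, ← h1, hGadj, Matrix.map_mul, Matrix.map_mul, transpose_map]
  refine ⟨t, MZ, ht, fun x j => ⟨idx x, rfl⟩, fun h0 => hGdet (by rw [hdet, h0]; rfl),
    fun i j => ?_⟩
  have h1 := congrFun (congrFun hfinal i) j
  simp only [Matrix.smul_apply, Matrix.sub_apply, smul_eq_mul, map_apply, Int.coe_castRingHom, one_apply] at h1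
  refine ⟨(MZ * MZᵀ).det * (if i = j then 1 else 0) -
    (MZᵀ * ((MZ * MZᵀ).adjugate * MZ)) i j, ?_⟩
  rw [Int.cast_sub, ← h1, Int.cast_mul, ← hdet]
  push_cast
  ring

/-- Leibniz bound: entries of `M Mᵀ` are at most `n * 2 ^ (2 * c) ≤ 2 ^ (3 * c)` and `t! ≤ 2 ^ (c *
c)`, so the exponents add up to `4 * c ^ 2`. -/
theorem det_mul_transpose_le {t n c : ℕ} {M : Matrix (Fin t) (Fin n) ℤ} (ht : t ≤ n) (hn : n ≤ c)
    (hM : ∀ x j, |M x j| ≤ 2 ^ c) : |(M * Mᵀ).det| ≤ 2 ^ (4 * c ^ 2) := by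
  have hn2 : (n : ℤ) ≤ 2 ^ c := by
    have h : n ≤ 2 ^ c := hn.trans (Nat.lt_two_pow_self (n := c)).le
    exact_mod_cast h
  have hent : ∀ x y, |(M * Mᵀ) x y| ≤ 2 ^ (3 * c) := by
    intro x y
    calc |(M * Mᵀ) x y| ≤ ∑ k, |M x k * M y k| := by
          rw [mul_apply]
          exact Finset.abs_sum_le_sum_abs _ _
      _ ≤ ∑ k : Fin n, 2 ^ c * 2 ^ c := Finset.sum_le_sum fun k _ => by
          rw [abs_mul]
          exact mul_le_mul (hM x k) (hM y k) (abs_nonneg _) (by positivity)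
      _ = n * (2 ^ c * 2 ^ c) := by simp
      _ ≤ 2 ^ c * (2 ^ c * 2 ^ c) := by gcongr
      _ = 2 ^ (3 * c) := by ring
  have hfac : (t.factorial : ℤ) ≤ 2 ^ (c * c) := by
    have h1 : t.factorial ≤ t ^ t := Nat.factorial_le_pow t
    have h2 : t ^ t ≤ (2 ^ c) ^ c :=
      (Nat.pow_le_pow_left ((ht.trans hn).trans (Nat.lt_two_pow_self (n := c)).le) t).trans
        (Nat.pow_le_pow_right (by positivity) (ht.trans hn))
    rw [← pow_mul] at h2
    exact_mod_cast h1.trans h2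
  have h := Matrix.det_le (abv := (AbsoluteValue.abs : AbsoluteValue ℤ ℤ)) hent
  rw [Fintype.card_fin, nsmul_eq_mul, AbsoluteValue.abs_apply, ← pow_mul] at h
  calc |(M * Mᵀ).det| ≤ _ := h
    _ ≤ 2 ^ (c * c) * 2 ^ (3 * c * c) := by
        refine mul_le_mul hfac (pow_le_pow_right₀ one_le_two ?_) (by positivity) (by positivity)
        exact Nat.mul_le_mul_left _ (ht.trans hn)
    _ = 2 ^ (4 * c ^ 2) := by ring

theorem le_inputBits {n : ℕ} (A Δ : Matrix (Fin n) (Fin n) ℚ) : n ≤ inputBits A Δ := by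
  have h1 : ∀ i j : Fin n, 1 ≤ ratBits (A i j) + ratBits (Δ i j) := fun i j => by
    unfold ratBits
    omega
  calc n ≤ n * n := Nat.le_mul_self n
    _ = ∑ _i : Fin n, ∑ _j : Fin n, 1 := by simp
    _ ≤ inputBits A Δ := Finset.sum_le_sum fun i _ => Finset.sum_le_sum fun j _ => h1 i j

theorem ratBits_add_le_inputBits {n : ℕ} (A Δ : Matrix (Fin n) (Fin n) ℚ) (i j : Fin n) :
    ratBits (A i j) + ratBits (Δ i j) ≤ inputBits A Δ :=
  (Finset.single_le_sum (f := fun j => ratBits (A i j) + ratBits (Δ i j))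
    (fun _ _ => Nat.zero_le _) (Finset.mem_univ j)).trans
  (Finset.single_le_sum (f := fun i => ∑ j, (ratBits (A i j) + ratBits (Δ i j)))
    (fun _ _ => Nat.zero_le _) (Finset.mem_univ i))

theorem IsKernelProjector.bitBounded {n : ℕ} {A P : Matrix (Fin n) (Fin n) ℚ}
    {I : Set (Fin n)} (h : IsKernelProjector A I P) (Δ : Matrix (Fin n) (Fin n) ℚ) (i j : Fin n) :
    BitBounded (16 * inputBits A Δ ^ 2) (P i j) := by
  set L := inputBits A Δ with hL
  -- The product of all denominators is at most `2 ^ L`, so the entries of `D A` are at most `2 ^ (2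
  -- * L)`; the determinant bound with `c = 2 * L` gives `16 * L ^ 2`.
  let D : ℕ := ∏ i, ∏ j, (A i j).den
  have hD0 : (D : ℤ) ≠ 0 := by
    have : D ≠ 0 := Finset.prod_ne_zero_iff.mpr fun i _ => Finset.prod_ne_zero_iff.mpr fun j _ =>
      (A i j).den_ne_zero
    exact_mod_cast this
  have hDle : D ≤ 2 ^ L := by
    rw [hL, inputBits, ← Finset.prod_pow_eq_pow_sum]
    refine Finset.prod_le_prod' fun i _ => ?_
    rw [← Finset.prod_pow_eq_pow_sum]
    refine Finset.prod_le_prod' fun j _ => (den_le_two_pow_ratBits _).trans ?_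
    exact Nat.pow_le_pow_right two_pos (Nat.le_add_right _ _)
  have hdvd : ∀ i j, (A i j).den ∣ D := fun i j =>
    (Finset.dvd_prod_of_mem (fun j => (A i j).den) (Finset.mem_univ j)).trans
      (Finset.dvd_prod_of_mem (fun i => ∏ j, (A i j).den) (Finset.mem_univ i))
  have hZ : ∀ i j, ∃ z : ℤ, ((D : ℤ) : ℚ) * A i j = z := by
    intro i j
    obtain ⟨k, hk⟩ := hdvd i j
    refine ⟨k * (A i j).num, ?_⟩
    rw [hk]
    push_cast
    rw [← Rat.den_mul_eq_num (A i j)]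
    ring
  choose Z hZ using hZ
  obtain ⟨t, M, ht, hMZ, hdet, hint⟩ := h.exists_common_denominator hD0 (Z := Matrix.of Z) hZ
  have hM : ∀ x j, |M x j| ≤ 2 ^ (2 * L) := by
    intro x j
    obtain ⟨i, hi⟩ := hMZ x j
    rw [hi, of_apply]
    have h1 : |(Z i j : ℚ)| ≤ 2 ^ (2 * L) := by
      rw [← hZ, abs_mul, two_mul, pow_add]
      refine mul_le_mul ?_ ?_ (abs_nonneg _) (by positivity)
      · rw [abs_of_nonneg (by positivity)]
        exact_mod_cast hDle
      · refine (abs_le_two_pow_ratBits _).trans (pow_le_pow_right₀ one_le_two ?_)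
        exact (Nat.le_add_right _ _).trans (ratBits_add_le_inputBits A Δ i j)
    exact_mod_cast h1
  refine ⟨(h.abs_apply_le_one i j).trans (one_le_pow₀ one_le_two), _, hdet, ?_, hint i j⟩
  refine (det_mul_transpose_le ht ((le_inputBits A Δ).trans (by omega)) hM).trans ?_
  exact pow_le_pow_right₀ one_le_two (by rw [mul_pow]; omega)

/-! ### Programs with a cost bound -/

@[simp]
theorem Mem.setIdx_arr {K : Type} (σ : Mem K) (r k : ℕ) : (σ.setIdx r k).arr = σ.arr := rfl

@[simp]
theorem Mem.setIdx_idx {K : Type} (σ : Mem K) (r k s : ℕ) :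
    (σ.setIdx r k).idx s = if s = r then k else σ.idx s := by
  simp [Mem.setIdx, Function.update_apply]

@[simp]
theorem Mem.write_idx {K : Type} (σ : Mem K) (a i j : ℕ) (x : K) :
    (σ.write a i j x).idx = σ.idx := rfl

theorem Mem.write_arr_ne {K : Type} (σ : Mem K) {a b : ℕ} (i j : ℕ) (x : K) (h : b ≠ a) :
    (σ.write a i j x).arr b = σ.arr b := by
  simp [Mem.write, h]

theorem Mem.write_arr {K : Type} (σ : Mem K) (a i j : ℕ) (x : K) (k l : ℕ) :
    (σ.write a i j x).arr a k l = if k = i ∧ l = j then x else σ.arr a k l := by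
  by_cases hk : k = i
  · subst hk
    by_cases hl : l = j <;> simp [Mem.write, hl]
  · simp [Mem.write, hk]

section Runs

variable {K : Type} [Field K] [LinearOrder K] {w : K → ℕ}

/-- Started in `σ`, the program halts at cost at most `c` in a memory satisfying `Q`. -/
def Runs (w : K → ℕ) (P : Prog) (σ : Mem K) (c : ℕ) (Q : Mem K → Prop) : Prop :=
  ∃ c' τ, Exec w P σ c' τ ∧ c' ≤ c ∧ Q τ

theorem Runs.mono {P : Prog} {σ : Mem K} {c d : ℕ} {Q R : Mem K → Prop} (h : Runs w P σ c Q)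
    (hcd : c ≤ d) (hQR : ∀ τ, Q τ → R τ) : Runs w P σ d R := by
  obtain ⟨c', τ, he, hc, hQ⟩ := h
  exact ⟨c', τ, he, hc.trans hcd, hQR τ hQ⟩

theorem Runs.skip {σ : Mem K} {Q : Mem K → Prop} (h : Q σ) : Runs w .skip σ 1 Q :=
  ⟨_, _, Exec.skip σ, le_rfl, h⟩

theorem Runs.setIdx {σ : Mem K} {r c : ℕ} {e : IdxExpr} {Q : Mem K → Prop}
    (hc : e.cost σ + 1 ≤ c) (h : Q (σ.setIdx r (e.val σ))) : Runs w (.setIdx r e) σ c Q :=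
  ⟨_, _, Exec.setIdx σ r e, hc, h⟩

theorem Runs.write {σ : Mem K} {a c : ℕ} {i j : IdxExpr} {x : NumExpr} {Q : Mem K → Prop}
    (hc : i.cost σ + j.cost σ + x.cost w σ + 1 ≤ c)
    (h : Q (σ.write a (i.val σ) (j.val σ) (x.val σ))) : Runs w (.write a i j x) σ c Q :=
  ⟨_, _, Exec.write σ a i j x, hc, h⟩

theorem Runs.seq {P P' : Prog} {σ : Mem K} {c d : ℕ} {Q R : Mem K → Prop} (h : Runs w P σ c Q)
    (h' : ∀ τ, Q τ → Runs w P' τ d R) : Runs w (.seq P P') σ (c + d) R := by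
  obtain ⟨c', τ, he, hc, hQ⟩ := h
  obtain ⟨d', υ, he', hd, hR⟩ := h' τ hQ
  exact ⟨_, υ, Exec.seq P P' σ τ υ c' d' he he', add_le_add hc hd, hR⟩

theorem Runs.ite {t : Test} {P P' : Prog} {σ : Mem K} {c d : ℕ} {Q : Mem K → Prop}
    (ht : t.cost w σ + 1 ≤ d) (h : t.Holds σ → Runs w P σ c Q)
    (h' : ¬ t.Holds σ → Runs w P' σ c Q) : Runs w (.ite t P P') σ (d + c) Q := by
  by_cases hσ : t.Holds σ
  · obtain ⟨c', τ, he, hc, hQ⟩ := h hσ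
    exact ⟨_, τ, Exec.iteTrue t P P' σ τ c' hσ he, add_le_add ht hc, hQ⟩
  · obtain ⟨c', τ, he, hc, hQ⟩ := h' hσ
    exact ⟨_, τ, Exec.iteFalse t P P' σ τ c' hσ he, add_le_add ht hc, hQ⟩

theorem natSize_le_self (k : ℕ) : Nat.size k ≤ k := Nat.size_le.mpr Nat.lt_two_pow_self

/-- Run the body with the register `r` going through the natural numbers below the content of the
register `0`. -/
def forLoop (r : ℕ) (body : Prog) : Prog :=
  .seq (.setIdx r (.const 0))
    (.loop (.neg (.idxLe (.reg 0) (.reg r)))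
      (.seq body (.setIdx r (.add (.reg r) (.const 1)))))

/-- The cost of a `forLoop` with `n` rounds whose body costs `c`. -/
def forCost {R : Type} [CommSemiring R] (n c : R) : R := (n + 1) * (c + 4 * n + 10)

/-- `Inv k` describes the memory at the loop test, with `k` in the register `r`; this is why the
body must yield `Inv (k + 1)` for the memory after the increment. -/
theorem Runs.forLoop {r n c : ℕ} {body : Prog} {σ : Mem K} {Inv : ℕ → Mem K → Prop} (hr : r ≠ 0)
    (hσ : σ.idx 0 = n) (hstart : Inv 0 (σ.setIdx r 0))
    (hbody : ∀ k < n, ∀ τ, τ.idx 0 = n → τ.idx r = k → Inv k τ →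
      Runs w body τ c fun υ => υ.idx 0 = n ∧ υ.idx r = k ∧ Inv (k + 1) (υ.setIdx r (k + 1))) :
    Runs w (forLoop r body) σ (forCost n c) fun τ => τ.idx 0 = n ∧ Inv n τ := by
  have hloop : ∀ m k, k + m = n → ∀ τ : Mem K, τ.idx 0 = n → τ.idx r = k → Inv k τ →
      Runs w (.loop (.neg (.idxLe (.reg 0) (.reg r)))
        (.seq body (.setIdx r (.add (.reg r) (.const 1))))) τ
        (m * (c + 4 * n + 10) + 2 * n + 5) fun τ => τ.idx 0 = n ∧ Inv n τ := by
    intro m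
    induction m with
    | zero =>
      intro k hk τ h0 hrk hI
      have hkn : k = n := by omega
      subst hkn
      refine ⟨_, τ, Exec.loopDone _ _ τ ?_, ?_, h0, hI⟩
      · simp [Test.Holds, IdxExpr.val, h0, hrk]
      · have := natSize_le_self k
        simp only [Test.cost, IdxExpr.cost, h0, hrk]
        omega
    | succ m ih =>
      intro k hk τ h0 hrk hI
      obtain ⟨c', υ, he, hc, h0', hrk', hI'⟩ := hbody k (by omega) τ h0 hrk hI
      have hval : (IdxExpr.add (.reg r) (.const 1)).val υ = k + 1 := by
        simp [IdxExpr.val, hrk']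
      obtain ⟨d, ω, he', hd, hω⟩ := ih (k + 1) (by omega) (υ.setIdx r (k + 1))
        (by simp [Ne.symm hr, h0']) (by simp) hI'
      have hset := Exec.setIdx (w := w) υ r (.add (.reg r) (.const 1))
      rw [hval] at hset
      refine ⟨_, ω, Exec.loopStep _ _ τ _ ω _ d ?_ (Exec.seq _ _ _ _ _ _ _ he hset) he', ?_, hω⟩
      · simp only [Test.Holds, IdxExpr.val, h0, hrk]
        omega
      -- The test and the increment handle four register values of bit length at most `n`, and ten
      -- further units.
      · have h1 := natSize_le_self k
        have h2 := natSize_le_self (k + 1)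
        have h3 := natSize_le_self n
        have h4 := natSize_le_self 1
        have h5 : (m + 1) * (c + 4 * n + 10) = m * (c + 4 * n + 10) + (c + 4 * n + 10) := by ring
        simp only [Test.cost, IdxExpr.cost, IdxExpr.val, h0, hrk, hrk']
        omega
  refine (Runs.seq (c := 2) (d := n * (c + 4 * n + 10) + 2 * n + 5)
    (Q := fun τ => τ.idx 0 = n ∧ τ.idx r = 0 ∧ Inv 0 τ) (Runs.setIdx ?_ ?_) ?_).mono ?_
    fun _ h => h
  · simp [IdxExpr.cost]
  · exact ⟨by simp [Ne.symm hr, hσ], by simp [IdxExpr.val], hstart⟩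
  · exact fun τ h => hloop n 0 (zero_add n) τ h.1 h.2.1 h.2.2
  · unfold forCost
    ring_nf
    omega

/-- Sum the expression `x` over the register `4` running below the content of the register `0`,
into the entry of the array `a` whose address is stored in the registers `6` and `e`. -/
def sumLoop (a e : ℕ) (x : NumExpr) : Prog :=
  .seq (.write a (.reg 6) (.reg e) .zero)
    (forLoop 4 (.write a (.reg 6) (.reg e) (.add (.read a (.reg 6) (.reg e)) x)))

/-- The cost of a `sumLoop` with `n` summands of size `b` that cost `c`. -/
def sumCost {R : Type} [CommSemiring R] (n b c : R) : R :=
  n + 7 + forCost n (c + 6 * (n * (b + 1)) + 2 * n + 13)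

theorem Runs.sumLoop {Bd : ℕ → K → Prop} (hB : IsSizeBound w Bd) {σ : Mem K} {n a e j b c : ℕ}
    {x : NumExpr} {f : Fin n → K} (h0 : σ.idx 0 = n) (h6 : σ.idx 6 = 0) (he : e ≠ 4)
    (hej : σ.idx e = j) (hj : j ≤ n) (hf : ∀ k, Bd b (f k))
    (hx : ∀ (k : Fin n) (τ : Mem K), τ.idx 4 = k → (∀ r ≠ 4, τ.idx r = σ.idx r) →
      (∀ a' ≠ a, τ.arr a' = σ.arr a') → x.val τ = f k ∧ x.cost w τ ≤ c) :
    Runs w (sumLoop a e x) σ (sumCost n b c) fun τ => (∀ r ≠ 4, τ.idx r = σ.idx r) ∧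
      (∀ a' ≠ a, τ.arr a' = σ.arr a') ∧ τ.arr a 0 j = ∑ k, f k ∧
      ∀ j' ≠ j, τ.arr a 0 j' = σ.arr a 0 j' := by
  have hw0 : w 0 ≤ 3 := by simpa using hB.weight_le hB.zero
  let g : ℕ → K := fun k => if h : k < n then f ⟨k, h⟩ else 0
  have hg : ∀ k < n, Bd b (g k) := fun k hk => by simpa [g, hk] using hf ⟨k, hk⟩
  -- Every partial sum is stored and charged, not only the total.
  have hgw : ∀ m ≤ n, w (∑ k ∈ Finset.range m, g k) ≤ 3 * (n * (b + 1)) + 3 := fun m hm =>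
    hB.weight_le (hB.mono (Nat.mul_le_mul_right _ hm) (hB.sum_range fun k hk => hg k (by omega)))
  have hsum : ∑ k, f k = ∑ k ∈ Finset.range n, g k := by
    rw [Finset.sum_range]
    exact Finset.sum_congr rfl fun k _ => by simp [g]
  have hsz : Nat.size j ≤ n := (natSize_le_self j).trans hj
  refine Runs.seq (Q := fun τ => (∀ r, τ.idx r = σ.idx r) ∧ (∀ a' ≠ a, τ.arr a' = σ.arr a') ∧
      τ.arr a 0 j = 0 ∧ ∀ j' ≠ j, τ.arr a 0 j' = σ.arr a 0 j') (Runs.write ?_ ?_) ?_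
  · simp only [IdxExpr.cost, NumExpr.cost, h6, hej, Nat.size_zero]
    omega
  · simp only [IdxExpr.val, NumExpr.val, h6, hej, Mem.write_idx]
    refine ⟨fun _ => trivial, fun a' ha' => Mem.write_arr_ne σ _ _ _ ha', ?_, fun j' hj' => ?_⟩
    · simp [Mem.write_arr]
    · simp [Mem.write_arr, hj']
  · rintro σ' ⟨hidx, harr, hacc, hrest⟩
    refine (Runs.forLoop (n := n) (Inv := fun m τ => (∀ r ≠ 4, τ.idx r = σ.idx r) ∧
      (∀ a' ≠ a, τ.arr a' = σ.arr a') ∧ τ.arr a 0 j = ∑ k ∈ Finset.range m, g k ∧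
      ∀ j' ≠ j, τ.arr a 0 j' = σ.arr a 0 j') (by norm_num) ((hidx 0).trans h0) ?_ ?_).mono le_rfl
      ?_
    · refine ⟨fun r hr => ?_, fun a' ha' => harr a' ha', ?_, hrest⟩
      · simp [hr, hidx]
      · simpa using hacc
    · rintro k hk τ hτ0 hτ4 ⟨hτi, hτa, hτs, hτr⟩
      have hτ6 : τ.idx 6 = 0 := (hτi 6 (by norm_num)).trans h6
      have hτe : τ.idx e = j := (hτi e he).trans hej
      obtain ⟨hv, hcost⟩ := hx ⟨k, hk⟩ τ hτ4 hτi hτa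
      have hgk : g k = f ⟨k, hk⟩ := by simp [g, hk]
      refine Runs.write ?_ ?_
      · have h1 := hgw k hk.le
        have h2 := hgw (k + 1) hk
        rw [Finset.sum_range_succ, hgk] at h2
        simp only [IdxExpr.cost, NumExpr.cost, NumExpr.val, IdxExpr.val, hτ6, hτe, hτs, hv,
          Nat.size_zero]
        omega
      · simp only [IdxExpr.val, NumExpr.val, hτ6, hτe, Mem.write_idx, hv, hτs]
        refine ⟨hτ0, hτ4, fun r hr => ?_, fun a' ha' => ?_, ?_, fun j' hj' => ?_⟩
        · simp [hr, hτi r hr]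
        · rw [Mem.setIdx_arr, Mem.write_arr_ne _ _ _ _ ha', hτa a' ha']
        · rw [Mem.setIdx_arr, Mem.write_arr, if_pos ⟨rfl, rfl⟩, Finset.sum_range_succ, hgk]
        · rw [Mem.setIdx_arr, Mem.write_arr, if_neg fun h => hj' h.2, hτr j' hj']
    · rintro τ ⟨-, hτ⟩
      rw [hsum]
      exact hτ

end Runs

/-! ### The program -/

/-- Project along the row of the array `0` given by the register `2`. -/
def projectProg : Prog :=
  .seq (forLoop 3 (sumLoop 3 3 (.mul (.read 2 (.reg 3) (.reg 4)) (.read 0 (.reg 2) (.reg 4)))))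
    (.seq (sumLoop 4 6 (.mul (.read 3 (.reg 6) (.reg 4)) (.read 3 (.reg 6) (.reg 4))))
      (forLoop 3 (forLoop 4 (.write 2 (.reg 3) (.reg 4)
        (.sub (.read 2 (.reg 3) (.reg 4))
          (.div (.mul (.read 3 (.reg 6) (.reg 3)) (.read 3 (.reg 6) (.reg 4)))
            (.read 4 (.reg 6) (.reg 6))))))))

/-- Process the row given by the register `2`. -/
def rowProg : Prog :=
  .seq (sumLoop 4 6 (.mul (.read 1 (.reg 2) (.reg 4)) (.read 2 (.reg 4) (.reg 4))))
    (.ite (.numLe (.read 4 (.reg 6) (.reg 6)) .zero) projectProg .skip)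

/-- The program deciding whether the regularity radius is infinite. -/
def radiusProg : Prog :=
  .seq (forLoop 1 (.write 2 (.reg 1) (.reg 1) .one))
    (.seq (forLoop 1 (forLoop 2 rowProg))
      (.seq (sumLoop 4 6 (.read 2 (.reg 4) (.reg 4)))
        (.ite (.numLe (.read 4 (.reg 6) (.reg 6)) .zero)
          (.setIdx 0 (.const 1)) (.setIdx 0 (.const 0)))))

/-! ### Cost expressions -/

section Cost

variable {R : Type} [CommSemiring R]

/-- The size of a scalar product of vectors of length `n` with entries of size `b`. -/
def dotSize (n b : R) : R := n * (2 * b + 1)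

/-- The semiring is arbitrary so that the same expression serves as a number bounding a run and as a
polynomial. -/
def projectCost (n b : R) : R :=
  forCost n (sumCost n (2 * b) (4 * n + 12 * b + 16)) +
    (sumCost n (2 * dotSize n b) (2 * n + 12 * dotSize n b + 16) +
      forCost n (forCost n (6 * n + 6 * b + 24 * dotSize n b + 15 * dotSize n (dotSize n b) + 42)))

def rowCost (n b : R) : R :=
  sumCost n (2 * b) (4 * n + 12 * b + 16) + (3 * dotSize n b + 12 + (projectCost n b + 1))

def radiusCost (n b : R) : R :=
  forCost n (2 * n + 7) + (forCost n (forCost n (rowCost n b)) +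
    (sumCost n (2 * b) (4 * n + 12 * b + 16) + (3 * dotSize n b + 12 + 3)))

end Cost

/-- The memory holds `A`, `Δ` and `P` in the arrays `0`, `1` and `2`, the dimension in the register
`0`, and zero in the register `6`. -/
structure Loaded {K : Type} {n : ℕ} (A Δ P : Matrix (Fin n) (Fin n) K) (σ : Mem K) : Prop where
  idx_zero : σ.idx 0 = n
  idx_six : σ.idx 6 = 0
  arr_zero : ∀ i j : Fin n, σ.arr 0 i j = A i j
  arr_one : ∀ i j : Fin n, σ.arr 1 i j = Δ i j
  arr_two : ∀ i j : Fin n, σ.arr 2 i j = P i j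

theorem Loaded.congr {K : Type} {n : ℕ} {A Δ P : Matrix (Fin n) (Fin n) K} {σ τ : Mem K}
    (h : Loaded A Δ P σ) (h0 : τ.idx 0 = σ.idx 0) (h6 : τ.idx 6 = σ.idx 6)
    (ha0 : τ.arr 0 = σ.arr 0) (ha1 : τ.arr 1 = σ.arr 1) (ha2 : τ.arr 2 = σ.arr 2) :
    Loaded A Δ P τ := by
  obtain ⟨h1, h2, h3, h4, h5⟩ := h
  constructor
  · rw [h0, h1]
  · rw [h6, h2]
  · rwa [ha0]
  · rwa [ha1]
  · rwa [ha2]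

theorem IsSizeBound.sum_fin {K : Type} [Field K] {w : K → ℕ} {Bd : ℕ → K → Prop} {n c : ℕ}
    (hB : IsSizeBound w Bd) {f : Fin n → K} (hf : ∀ k, Bd (2 * c) (f k)) :
    Bd (dotSize n c) (∑ k, f k) := by
  have := hB.sum_range (f := fun k => if h : k < n then f ⟨k, h⟩ else 0) (b := 2 * c) (m := n)
    fun k hk => by simpa [hk] using hf ⟨k, hk⟩
  rw [Finset.sum_range] at this
  simpa [dotSize] using this

theorem loaded_inputMem {K : Type} [Field K] {n : ℕ} (A Δ : Matrix (Fin n) (Fin n) K) :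
    Loaded A Δ 0 (inputMem A Δ) := by
  constructor <;> simp [inputMem]

/-! ### Correctness and cost of the program -/

section Spec

variable {K : Type} [Field K] [LinearOrder K] {w : K → ℕ} {Bd : ℕ → K → Prop} {n b : ℕ}
  {A Δ P : Matrix (Fin n) (Fin n) K} {σ : Mem K}

/-- Only intermediate sizes are tracked here. That the new matrix again has entries of size `b`
follows from its being a kernel projector, not from the arithmetic that produced it. -/
theorem Runs.projectProg (hB : IsSizeBound w Bd) (hA : ∀ i j, Bd b (A i j))
    (hP : ∀ i j, Bd b (P i j)) (hσ : Loaded A Δ P σ) (i : Fin n) (h2 : σ.idx 2 = i) :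
    Runs w projectProg σ (projectCost n b) fun τ => Loaded A Δ (Matrix.of fun j k =>
      P j k - (P *ᵥ A i) j * (P *ᵥ A i) k / (P *ᵥ A i ⬝ᵥ P *ᵥ A i)) τ ∧
      τ.idx 1 = σ.idx 1 ∧ τ.idx 2 = i := by
  set v := P *ᵥ A i with hv
  have hsz : ∀ k : Fin n, Nat.size k ≤ n := fun k => (natSize_le_self k).trans k.2.le
  have hPA : ∀ j k, Bd (2 * b) (P j k * A i k) := fun j k => by
    rw [two_mul]
    exact hB.mul (hP j k) (hA i k)
  have hvb : ∀ j, Bd (dotSize n b) (v j) := fun j => hB.sum_fin (hPA j)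
  have hvv : ∀ j k, Bd (2 * dotSize n b) (v j * v k) := fun j k => by
    rw [two_mul]
    exact hB.mul (hvb j) (hvb k)
  have hsb : Bd (dotSize n (dotSize n b)) (v ⬝ᵥ v) := hB.sum_fin fun k => hvv k k
  refine Runs.seq (Q := fun τ => Loaded A Δ P τ ∧ τ.idx 1 = σ.idx 1 ∧ τ.idx 2 = i ∧
    ∀ j : Fin n, τ.arr 3 0 j = v j) ?_ ?_
  · refine (Runs.forLoop (n := n) (Inv := fun m τ => Loaded A Δ P τ ∧ τ.idx 1 = σ.idx 1 ∧
      τ.idx 2 = i ∧ ∀ j : Fin n, (j : ℕ) < m → τ.arr 3 0 j = v j) (by norm_num) hσ.idx_zero ?_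
      ?_).mono le_rfl ?_
    · exact ⟨hσ.congr (by simp) (by simp) rfl rfl rfl, by simp, by simp [h2], by simp⟩
    · rintro j hj τ - hτ3 ⟨hτ, hτ1, hτ2, hτv⟩
      refine (Runs.sumLoop hB (f := fun k => P ⟨j, hj⟩ k * A i k) (b := 2 * b)
        (c := 4 * n + 12 * b + 16) hτ.idx_zero hτ.idx_six (by norm_num) hτ3 hj.le
        (hPA ⟨j, hj⟩) ?_).mono le_rfl ?_
      · intro k υ hυ4 hυi hυa
        have e3 : υ.idx 3 = j := (hυi 3 (by norm_num)).trans hτ3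
        have e2 : υ.idx 2 = i := (hυi 2 (by norm_num)).trans hτ2
        have eP : υ.arr 2 j k = P ⟨j, hj⟩ k := by
          rw [hυa 2 (by norm_num)]
          exact hτ.arr_two ⟨j, hj⟩ k
        have eA : υ.arr 0 i k = A i k := by
          rw [hυa 0 (by norm_num)]
          exact hτ.arr_zero i k
        have w1 := hB.weight_le (hP ⟨j, hj⟩ k)
        have w2 := hB.weight_le (hA i k)
        have w3 := hB.weight_le (hPA ⟨j, hj⟩ k)
        have s1 := hsz i
        have s2 := hsz k
        have s3 := hsz ⟨j, hj⟩
        simp only [NumExpr.val, NumExpr.cost, IdxExpr.val, IdxExpr.cost, hυ4, e3, e2, eP, eA]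
        exact ⟨trivial, by simp only at s3; omega⟩
      · rintro υ ⟨hυi, hυa, hυv, hυr⟩
        have e0 := hυi 0 (by norm_num)
        have e1 := hυi 1 (by norm_num)
        have e2 := hυi 2 (by norm_num)
        have e3 := hυi 3 (by norm_num)
        have e6 := hυi 6 (by norm_num)
        refine ⟨e0.trans hτ.idx_zero, e3.trans hτ3, hτ.congr (by simpa using e0)
          (by simpa using e6) (hυa 0 (by norm_num)) (hυa 1 (by norm_num)) (hυa 2 (by norm_num)),
          by simpa using e1.trans hτ1, by simpa using e2.trans hτ2, fun l hl => ?_⟩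
        rw [Mem.setIdx_arr]
        by_cases hlj : (l : ℕ) = j
        · have : l = ⟨j, hj⟩ := Fin.ext hlj
          rw [hlj, hυv, this]
          rfl
        · rw [hυr l hlj, hτv l (by omega)]
    · rintro τ ⟨-, hτ, hτ1, hτ2, hτv⟩
      exact ⟨hτ, hτ1, hτ2, fun j => hτv j j.2⟩
  rintro σ₁ ⟨hσ₁, h11, h12, hv1⟩
  refine Runs.seq (Q := fun τ => Loaded A Δ P τ ∧ τ.idx 1 = σ.idx 1 ∧ τ.idx 2 = i ∧
    (∀ j : Fin n, τ.arr 3 0 j = v j) ∧ τ.arr 4 0 0 = v ⬝ᵥ v) ?_ ?_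
  · refine (Runs.sumLoop hB (f := fun k => v k * v k) (b := 2 * dotSize n b)
      (c := 2 * n + 12 * dotSize n b + 16) hσ₁.idx_zero hσ₁.idx_six (by norm_num) hσ₁.idx_six
      (Nat.zero_le n) (fun k => hvv k k) ?_).mono le_rfl ?_
    · intro k υ hυ4 hυi hυa
      have e6 : υ.idx 6 = 0 := (hυi 6 (by norm_num)).trans hσ₁.idx_six
      have ev : υ.arr 3 0 k = v k := by rw [hυa 3 (by norm_num), hv1]
      have w1 := hB.weight_le (hvb k)
      have w2 := hB.weight_le (hvv k k)
      have s1 := hsz k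
      simp only [NumExpr.val, NumExpr.cost, IdxExpr.val, IdxExpr.cost, hυ4, e6, ev, Nat.size_zero]
      exact ⟨trivial, by omega⟩
    · rintro υ ⟨hυi, hυa, hυv, -⟩
      exact ⟨hσ₁.congr (hυi 0 (by norm_num)) (hυi 6 (by norm_num)) (hυa 0 (by norm_num))
        (hυa 1 (by norm_num)) (hυa 2 (by norm_num)), (hυi 1 (by norm_num)).trans h11,
        (hυi 2 (by norm_num)).trans h12, fun j => by rw [hυa 3 (by norm_num), hv1], hυv⟩
  rintro σ₂ ⟨hσ₂, h21, h22, hv2, hs2⟩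
  set P' : Matrix (Fin n) (Fin n) K := Matrix.of fun j k =>
    P j k - v j * v k / (v ⬝ᵥ v) with hP'
  have key : ∀ {τ : Mem K}, τ.idx 0 = n → τ.idx 6 = 0 → τ.idx 1 = σ.idx 1 → τ.idx 2 = i →
      τ.arr 0 = σ₂.arr 0 → τ.arr 1 = σ₂.arr 1 → (∀ j k : Fin n, τ.arr 2 j k = P' j k) →
      Loaded A Δ P' τ ∧ τ.idx 1 = σ.idx 1 ∧ τ.idx 2 = i := by
    intro τ t0 t6 t1 t2 a0 a1 a2
    exact ⟨⟨t0, t6, by rw [a0]; exact hσ₂.arr_zero, by rw [a1]; exact hσ₂.arr_one, a2⟩, t1, t2⟩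
  -- Overwriting in place is safe: the new entry at `(j, k)` needs only the old one at `(j, k)`, the
  -- saved `v` and `v ⬝ᵥ v`.
  refine (Runs.forLoop (n := n) (Inv := fun m τ => τ.idx 6 = 0 ∧ τ.idx 1 = σ.idx 1 ∧
    τ.idx 2 = i ∧ (∀ a ≠ 2, τ.arr a = σ₂.arr a) ∧
    ∀ j k : Fin n, τ.arr 2 j k = if (j : ℕ) < m then P' j k else P j k) (by norm_num)
    hσ₂.idx_zero ?_ ?_).mono le_rfl ?_
  · exact ⟨by simp [hσ₂.idx_six], by simp [h21], by simp [h22], fun _ _ => rfl,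
      by simpa using hσ₂.arr_two⟩
  · rintro j hj τ hτ0 hτ3 ⟨hτ6, hτ1, hτ2, hτa, hτP⟩
    refine (Runs.forLoop (n := n) (Inv := fun m τ => τ.idx 3 = j ∧ τ.idx 6 = 0 ∧
      τ.idx 1 = σ.idx 1 ∧ τ.idx 2 = i ∧ (∀ a ≠ 2, τ.arr a = σ₂.arr a) ∧
      ∀ l k : Fin n, τ.arr 2 l k =
        if (l : ℕ) < j ∨ (l : ℕ) = j ∧ (k : ℕ) < m then P' l k else P l k) (by norm_num)
      hτ0 ?_ ?_).mono le_rfl ?_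
    · exact ⟨by simp [hτ3], by simp [hτ6], by simp [hτ1], by simp [hτ2], hτa,
        by simpa using hτP⟩
    · rintro k hk υ hυ0 hυ4 ⟨hυ3, hυ6, hυ1, hυ2, hυa, hυP⟩
      have eP : υ.arr 2 j k = P ⟨j, hj⟩ ⟨k, hk⟩ := by
        have := hυP ⟨j, hj⟩ ⟨k, hk⟩
        simpa using this
      have ev : ∀ l (hl : l < n), υ.arr 3 0 l = v ⟨l, hl⟩ := fun l hl => by
        rw [hυa 3 (by norm_num)]
        exact hv2 ⟨l, hl⟩
      have es : υ.arr 4 0 0 = v ⬝ᵥ v := by rw [hυa 4 (by norm_num), hs2]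
      refine Runs.write ?_ ?_
      · have w1 := hB.weight_le (hP ⟨j, hj⟩ ⟨k, hk⟩)
        have w2 := hB.weight_le (hvb ⟨j, hj⟩)
        have w3 := hB.weight_le (hvb ⟨k, hk⟩)
        have w4 := hB.weight_le (hvv ⟨j, hj⟩ ⟨k, hk⟩)
        have w5 := hB.weight_le hsb
        have h6 := hB.div (hvv ⟨j, hj⟩ ⟨k, hk⟩) hsb
        have w6 := hB.weight_le h6
        have w7 := hB.weight_le (hB.sub (hP ⟨j, hj⟩ ⟨k, hk⟩) h6)
        have s1 : Nat.size j ≤ n := hsz ⟨j, hj⟩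
        have s2 : Nat.size k ≤ n := hsz ⟨k, hk⟩
        simp only [NumExpr.val, NumExpr.cost, IdxExpr.val, IdxExpr.cost, hυ3, hυ4, hυ6, eP,
          ev j hj, ev k hk, es, Nat.size_zero]
        omega
      · simp only [NumExpr.val, IdxExpr.val, hυ3, hυ4, hυ6, eP, ev j hj, ev k hk, es,
          Mem.write_idx]
        refine ⟨hυ0, trivial, by simp [hυ3], by simp [hυ6], by simp [hυ1], by simp [hυ2],
          fun a ha => ?_, fun l m => ?_⟩
        · rw [Mem.setIdx_arr, Mem.write_arr_ne _ _ _ _ ha, hυa a ha]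
        · rw [Mem.setIdx_arr, Mem.write_arr]
          by_cases hlm : (l : ℕ) = j ∧ (m : ℕ) = k
          · have hl : l = ⟨j, hj⟩ := Fin.ext hlm.1
            have hm : m = ⟨k, hk⟩ := Fin.ext hlm.2
            rw [if_pos hlm, if_pos (Or.inr ⟨hlm.1, by omega⟩), hl, hm]
            rfl
          · rw [if_neg hlm, hυP]
            congr 1
            simp only [eq_iff_iff]
            omega
    · rintro υ ⟨hυ0, hυ3, hυ6, hυ1, hυ2, hυa, hυP⟩
      refine ⟨hυ0, hυ3, by simp [hυ6], by simp [hυ1], by simp [hυ2], hυa, fun l k => ?_⟩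
      rw [Mem.setIdx_arr, hυP]
      congr 1
      have := k.2
      simp only [eq_iff_iff]
      omega
  · rintro τ ⟨hτ0, hτ6, hτ1, hτ2, hτa, hτP⟩
    exact key hτ0 hτ6 hτ1 hτ2 (hτa 0 (by norm_num)) (hτa 1 (by norm_num))
      fun j k => by rw [hτP, if_pos j.2]

theorem Runs.rowProg (hB : IsSizeBound w Bd) (hA : ∀ i j, Bd b (A i j))
    (hΔ : ∀ i j, Bd b (Δ i j)) {s : ProjState K n} (hP : ∀ i j, Bd b (s.proj i j))
    (hσ : Loaded A Δ s.proj σ) (i : Fin n) (h2 : σ.idx 2 = i) :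
    Runs w rowProg σ (rowCost n b) fun τ =>
      Loaded A Δ (ProjState.step A Δ i s).proj τ ∧ τ.idx 1 = σ.idx 1 ∧ τ.idx 2 = i := by
  have hsz : ∀ k : Fin n, Nat.size k ≤ n := fun k => (natSize_le_self k).trans k.2.le
  have hterm : ∀ k, Bd (2 * b) (Δ i k * s.proj k k) := fun k => by
    rw [two_mul]
    exact hB.mul (hΔ i k) (hP k k)
  refine Runs.seq (Q := fun τ => Loaded A Δ s.proj τ ∧ τ.idx 1 = σ.idx 1 ∧ τ.idx 2 = i ∧
    τ.arr 4 0 0 = ∑ k, Δ i k * s.proj k k) ?_ ?_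
  · refine (Runs.sumLoop hB (f := fun k => Δ i k * s.proj k k) (b := 2 * b)
      (c := 4 * n + 12 * b + 16) hσ.idx_zero hσ.idx_six (by norm_num) hσ.idx_six
      (Nat.zero_le n) hterm ?_).mono le_rfl ?_
    · intro k υ hυ4 hυi hυa
      have e2 : υ.idx 2 = i := (hυi 2 (by norm_num)).trans h2
      have eP : υ.arr 2 k k = s.proj k k := by rw [hυa 2 (by norm_num), hσ.arr_two]
      have eD : υ.arr 1 i k = Δ i k := by rw [hυa 1 (by norm_num), hσ.arr_one]
      have w1 := hB.weight_le (hP k k)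
      have w2 := hB.weight_le (hΔ i k)
      have w3 := hB.weight_le (hterm k)
      have s1 := hsz i
      have s2 := hsz k
      simp only [NumExpr.val, NumExpr.cost, IdxExpr.val, IdxExpr.cost, hυ4, e2, eP, eD]
      exact ⟨trivial, by omega⟩
    · rintro υ ⟨hυi, hυa, hυv, -⟩
      exact ⟨hσ.congr (hυi 0 (by norm_num)) (hυi 6 (by norm_num)) (hυa 0 (by norm_num))
        (hυa 1 (by norm_num)) (hυa 2 (by norm_num)), hυi 1 (by norm_num),
        (hυi 2 (by norm_num)).trans h2, hυv⟩
  rintro τ ⟨hτ, hτ1, hτ2, hτs⟩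
  have hholds : Test.Holds τ (.numLe (.read 4 (.reg 6) (.reg 6)) .zero) ↔
      ∑ k, Δ i k * s.proj k k ≤ 0 := by
    simp only [Test.Holds, NumExpr.val, IdxExpr.val, hτ.idx_six, hτs]
  refine Runs.ite ?_ (fun h => ?_) fun h => ?_
  · have w0 := hB.weight_le hB.zero
    have w1 := hB.weight_le (hB.sum_fin hterm)
    simp only [Test.cost, NumExpr.cost, IdxExpr.val, IdxExpr.cost, hτ.idx_six, hτs, Nat.size_zero]
    omega
  · rw [hholds] at h
    refine (Runs.projectProg hB hA hP hτ i hτ2).mono (Nat.le_succ _) ?_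
    rintro υ ⟨hυ, hυ1, hυ2⟩
    refine ⟨?_, hυ1.trans hτ1, hυ2⟩
    unfold ProjState.step
    rwa [if_pos h]
  · rw [hholds] at h
    refine (Runs.skip (Q := fun υ => Loaded A Δ (ProjState.step A Δ i s).proj υ ∧
      υ.idx 1 = σ.idx 1 ∧ υ.idx 2 = i) ⟨?_, hτ1, hτ2⟩).mono (Nat.le_add_left _ _) fun _ h => h
    unfold ProjState.step
    rwa [if_neg h]

theorem radiusProg_decidesWithin [IsStrictOrderedRing K] (hB : IsSizeBound w Bd)
    (hA : ∀ i j, Bd b (A i j)) (hΔ : ∀ i j, Bd b (Δ i j))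
    (hproj : ∀ I P, IsKernelProjector A I P → ∀ i j, Bd b (P i j)) :
    radiusProg.DecidesWithin w (inputMem A Δ) (radiusCost n b) (ProjState.Accepts A Δ) := by
  have hsz : ∀ k : Fin n, Nat.size k ≤ n := fun k => (natSize_le_self k).trans k.2.le
  -- The uniform bound on projectors restores the size `b` before each step, so nothing compounds
  -- over the `n ^ 2` steps.
  have hvalid : ∀ {s : ProjState K n}, s.Valid A → ∀ i j, Bd b (s.proj i j) :=
    fun hs => hproj _ _ hs
  suffices h : Runs w radiusProg (inputMem A Δ) (radiusCost n b) fun τ =>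
      (ProjState.Accepts A Δ → τ.idx 0 = 1) ∧ (¬ ProjState.Accepts A Δ → τ.idx 0 = 0) by
    obtain ⟨c, τ, he, hc, hτ⟩ := h
    exact ⟨c, τ, he, hc, hτ⟩
  have hin : Loaded A Δ 0 (inputMem A Δ) := loaded_inputMem A Δ
  refine Runs.seq (Q := Loaded A Δ 1) ?_ ?_
  · refine (Runs.forLoop (n := n) (Inv := fun m τ => Loaded A Δ (Matrix.of fun i j =>
      if (i : ℕ) < m ∧ i = j then 1 else 0) τ) (by norm_num) hin.idx_zero ?_ ?_).mono le_rfl ?_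
    · convert hin.congr (τ := (inputMem A Δ).setIdx 1 0) (by simp) (by simp) rfl rfl rfl using 1
      ext
      simp
    · rintro k hk τ hτ0 hτ1 hτ
      refine Runs.write ?_ ?_
      · have w1 := hB.weight_le hB.one
        have s1 : Nat.size k ≤ n := hsz ⟨k, hk⟩
        simp only [NumExpr.cost, IdxExpr.cost, hτ1]
        omega
      · simp only [NumExpr.val, IdxExpr.val, hτ1]
        refine ⟨hτ0, hτ1, ⟨by simp [hτ0], by simp [hτ.idx_six], fun i j => ?_, fun i j => ?_,
          fun i j => ?_⟩⟩
        · rw [Mem.setIdx_arr, Mem.write_arr_ne _ _ _ _ (by norm_num), hτ.arr_zero]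
        · rw [Mem.setIdx_arr, Mem.write_arr_ne _ _ _ _ (by norm_num), hτ.arr_one]
        · rw [Mem.setIdx_arr, Mem.write_arr, hτ.arr_two, of_apply, of_apply]
          by_cases hij : i = j
          · subst hij
            by_cases hik : (i : ℕ) = k
            · simp [hik]
            · have : (i : ℕ) < k + 1 ↔ (i : ℕ) < k := by omega
              simp [hik, this]
          · have : ¬ ((i : ℕ) = k ∧ (j : ℕ) = k) := fun h => hij (Fin.ext (h.1.trans h.2.symm))
            simp [hij, this]
    · rintro τ ⟨-, hτ⟩
      convert hτ using 1
      ext i j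
      simp [one_apply]
  intro σ₁ hσ₁
  refine Runs.seq (Q := Loaded A Δ (ProjState.rounds A Δ n).proj) ?_ ?_
  · refine (Runs.forLoop (n := n) (Inv := fun m τ => Loaded A Δ (ProjState.rounds A Δ m).proj τ)
      (by norm_num) hσ₁.idx_zero (hσ₁.congr (by simp) (by simp) rfl rfl rfl) ?_).mono le_rfl
      fun τ h => h.2
    rintro r - τ hτ0 hτ1 hτ
    have hr := ProjState.valid_rounds (A := A) (Δ := Δ) r
    refine (Runs.forLoop (n := n) (Inv := fun m τ =>
      Loaded A Δ (ProjState.sweep A Δ m (ProjState.rounds A Δ r)).proj τ ∧ τ.idx 1 = r)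
      (by norm_num) hτ0 ⟨hτ.congr (by simp) (by simp) rfl rfl rfl, by simp [hτ1]⟩ ?_).mono le_rfl
      ?_
    · rintro i hi υ hυ0 hυ2 ⟨hυ, hυ1⟩
      refine (Runs.rowProg hB hA hΔ (hvalid (hr.sweep i)) hυ ⟨i, hi⟩ hυ2).mono le_rfl ?_
      rintro ω ⟨hω, hω1, hω2⟩
      refine ⟨hω.idx_zero, hω2, ?_, by simp [hω1, hυ1]⟩
      unfold ProjState.sweep
      rw [dif_pos hi]
      exact hω.congr (by simp) (by simp) rfl rfl rfl
    · rintro υ ⟨hυ0, hυ, hυ1⟩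
      exact ⟨hυ0, hυ1, hυ.congr (by simp) (by simp) rfl rfl rfl⟩
  intro σ₂ hσ₂
  have hP := hvalid (ProjState.valid_rounds (A := A) (Δ := Δ) n)
  -- Size `b` would do; `2 * b` allows the estimates for scalar products to be reused.
  have hterm : ∀ k, Bd (2 * b) ((ProjState.rounds A Δ n).proj k k) := fun k =>
    hB.mono (by omega) (hP k k)
  refine Runs.seq (Q := fun τ => τ.idx 6 = 0 ∧
    τ.arr 4 0 0 = ∑ k, (ProjState.rounds A Δ n).proj k k) ?_ ?_
  · refine (Runs.sumLoop hB (f := fun k => (ProjState.rounds A Δ n).proj k k) (b := 2 * b)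
      (c := 4 * n + 12 * b + 16) hσ₂.idx_zero hσ₂.idx_six (by norm_num) hσ₂.idx_six
      (Nat.zero_le n) hterm ?_).mono le_rfl ?_
    · intro k υ hυ4 hυi hυa
      have eP : υ.arr 2 k k = (ProjState.rounds A Δ n).proj k k := by
        rw [hυa 2 (by norm_num), hσ₂.arr_two]
      have w1 := hB.weight_le (hP k k)
      have s2 := hsz k
      simp only [NumExpr.val, NumExpr.cost, IdxExpr.val, IdxExpr.cost, hυ4, eP]
      exact ⟨trivial, by omega⟩
    · rintro υ ⟨hυi, -, hυv, -⟩
      exact ⟨(hυi 6 (by norm_num)).trans hσ₂.idx_six, hυv⟩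
  rintro τ ⟨hτ6, hτs⟩
  have hholds : Test.Holds τ (.numLe (.read 4 (.reg 6) (.reg 6)) .zero) ↔
      ProjState.Accepts A Δ := by
    simp only [Test.Holds, NumExpr.val, IdxExpr.val, hτ6, hτs, ProjState.Accepts]
  refine Runs.ite ?_ (fun h => ?_) fun h => ?_
  · have w0 := hB.weight_le hB.zero
    have w1 := hB.weight_le (hB.sum_fin hterm)
    simp only [Test.cost, NumExpr.cost, IdxExpr.val, IdxExpr.cost, hτ6, hτs, Nat.size_zero]
    omega
  · rw [hholds] at h
    refine Runs.setIdx (by simp [IdxExpr.cost]) ?_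
    simp [IdxExpr.val, h]
  · rw [hholds] at h
    refine Runs.setIdx (by simp [IdxExpr.cost]) ?_
    simp [IdxExpr.val, h]

end Spec

/-! ### The polynomial bound in the two cost models -/

theorem radiusCost_mono {m n b c : ℕ} (hmn : m ≤ n) (hbc : b ≤ c) :
    radiusCost m b ≤ radiusCost n c := by
  unfold radiusCost rowCost projectCost sumCost dotSize forCost
  gcongr

/-- A polynomial bound for the cost of the program. -/
noncomputable def radiusPoly : Polynomial ℕ :=
  radiusCost Polynomial.X (16 * Polynomial.X ^ 2 + Polynomial.X)

theorem radiusPoly_eval (L : ℕ) : radiusPoly.eval L = radiusCost L (16 * L ^ 2 + L) := by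
  simp [radiusPoly, radiusCost, rowCost, projectCost, sumCost, dotSize, forCost]

theorem Prog.DecidesWithin.congr {K : Type} [Field K] [LinearOrder K] {P : Prog} {w : K → ℕ}
    {σ : Mem K} {c d : ℕ} {Q R : Prop} (h : P.DecidesWithin w σ c Q) (hcd : c ≤ d)
    (hQR : R ↔ Q) : P.DecidesWithin w σ d R := by
  obtain ⟨c', τ, he, hc, h1, h2⟩ := h
  exact ⟨c', τ, he, hc.trans hcd, fun hr => h1 (hQR.mp hr), fun hr => h2 fun hq => hr (hQR.mpr hq)⟩

theorem radiusProg_decidesWithin_real {n : ℕ} {A Δ : Matrix (Fin n) (Fin n) ℝ}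
    (hΔ : ∀ i j, 0 ≤ Δ i j) :
    radiusProg.DecidesWithin (fun _ => 0) (inputMem A Δ) (radiusPoly.eval n)
      (regularityRadius A Δ = ⊤) := by
  refine (radiusProg_decidesWithin (b := 0) isSizeBound_trivial (fun _ _ => trivial)
    (fun _ _ => trivial) fun _ _ _ _ _ => trivial).congr ?_
    (ProjState.regularityRadius_eq_top_iff hΔ)
  rw [radiusPoly_eval]
  exact radiusCost_mono le_rfl (Nat.zero_le _)

theorem radiusProg_decidesWithin_rat {n : ℕ} {A Δ : Matrix (Fin n) (Fin n) ℚ}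
    (hΔ : ∀ i j, 0 ≤ Δ i j) :
    radiusProg.DecidesWithin ratBits (inputMem A Δ) (radiusPoly.eval (inputBits A Δ))
      (regularityRadius (A.map (fun q : ℚ => (q : ℝ))) (Δ.map (fun q : ℚ => (q : ℝ))) = ⊤) := by
  have hbits := ratBits_add_le_inputBits A Δ
  -- The summand `16 * L ^ 2` covers the projectors, the summand `L` the input entries.
  refine (radiusProg_decidesWithin (b := 16 * inputBits A Δ ^ 2 + inputBits A Δ)
    isSizeBound_ratBits (fun i j => bitBounded_of_ratBits_le ?_)
    (fun i j => bitBounded_of_ratBits_le ?_)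
    fun I P hP i j => (hP.bitBounded Δ i j).mono (Nat.le_add_right _ _)).congr ?_ ?_
  · have := hbits i j
    omega
  · have := hbits i j
    omega
  · rw [radiusPoly_eval]
    exact radiusCost_mono (le_inputBits A Δ) le_rfl
  · rw [ProjState.regularityRadius_eq_top_iff fun i j => by simpa using hΔ i j]
    exact ProjState.accepts_map (Rat.castHom ℝ) Rat.cast_strictMono

end RegRadius

theorem mainTheorem1 :
    -- the decision problem is polynomial, in the real number model and in the bit model
    (∃ (P : RegRadius.Prog) (p : Polynomial ℕ),
      (∀ (n : ℕ) (A Δ : Matrix (Fin n) (Fin n) ℝ), (∀ i j, 0 ≤ Δ i j) →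
        P.DecidesWithin (fun _ => 0) (RegRadius.inputMem A Δ) (p.eval n)
          (RegRadius.regularityRadius A Δ = ⊤)) ∧
      (∀ (n : ℕ) (A Δ : Matrix (Fin n) (Fin n) ℚ), (∀ i j, 0 ≤ Δ i j) →
        P.DecidesWithin RegRadius.ratBits (RegRadius.inputMem A Δ)
          (p.eval (RegRadius.inputBits A Δ))
          (RegRadius.regularityRadius (A.map (fun q : ℚ => (q : ℝ)))
            (Δ.map (fun q : ℚ => (q : ℝ))) = ⊤))) ∧
    -- the reduction procedure always ends, after at most `n ^ 2` steps, and for a nonsingular `A`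
    -- the radius is infinite if and only if it ends with the full index set
    (∀ (n : ℕ) (A Δ : Matrix (Fin n) (Fin n) ℝ), (∀ i j, 0 ≤ Δ i j) →
      (∀ (m : ℕ) (S : ℕ → RegRadius.Stage n), S 0 = RegRadius.Stage.initial Δ →
        (∀ k < m, RegRadius.Stage.Step A (S k) (S (k + 1))) → m ≤ n ^ 2) ∧
      (A.det ≠ 0 → ∀ S : RegRadius.Stage n, RegRadius.Stage.EndsAt A Δ S →
        (RegRadius.regularityRadius A Δ = ⊤ ↔ S.rows = Set.univ))) := by
  refine ⟨⟨RegRadius.radiusProg, RegRadius.radiusPoly,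
    fun n A Δ hΔ => RegRadius.radiusProg_decidesWithin_real hΔ,
    fun n A Δ hΔ => RegRadius.radiusProg_decidesWithin_rat hΔ⟩, fun n A Δ hΔ => ⟨?_, ?_⟩⟩
  · exact fun m S _ hS => RegRadius.Stage.length_le m S hS
  · exact fun hA S hS => hS.regularityRadius_eq_top_iff hΔ hA
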